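/- Let $\gamma>0$ and $b\ge 0$. Let $C([0,\infty])$ be the Banach space of (real- or complex-valued) continuous functions on $[0,\infty[$ that have a finite limit at $+\infty$, with the sup-norm. For $f\in C([0,\infty])$ and $x\ge 0$ put $P_0^{\gamma,b}f=f$ and, for $t>0$, $$P_t^{\gamma,b}f(x)=\int_0^\infty p^{\gamma,b}(x,y,t)f(y)\,dy,$$ where, if $b>0$, $$p^{\gamma,b}(x,y,t)=(\gamma t)^{-b/\gamma}e^{-\frac{x+y}{\gamma t}}y^{\frac b\gamma-1}\sum_{m=0}^\infty\frac{1}{m!\,\Gamma(m+\frac b\gamma)}\frac{x^my^m}{\gamma^{2m}t^{2m}},$$ and, if $b=0$, with $\delta_0$ the unit point mass at $0$, $$p^{\gamma,0}(x,y,t)=e^{-\frac{x}{\gamma t}}\delta_0(y)+(\gamma t)^{-1}e^{-\frac{x+y}{\gamma t}}\sum_{m=0}^\infty\frac{1}{(m+1)!\,m!}\frac{x^{m+1}y^m}{\gamma^{2m+1}t^{2m+1}}.$$ Let $A^{\gamma,b}u(x)=\gamma xu''(x)+bu'(x)$ for $x>0$, with domain $$D(A^{\gamma,0})=\Big\{u\in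 C([0,\infty])\cap C^2(]0,\infty[)\;\Big|\;\lim_{x\to0^+}A^{\gamma,0}u(x)=0,\ \lim_{x\to+\infty}A^{\gamma,0}u(x)=0\Big\}$$ if $b=0$, and $$D(A^{\gamma,b})=\Big\{u\in C^1([0,\infty[)\cap C^2(]0,\infty[)\cap C([0,\infty])\;\Big|\;\lim_{x\to0^+}xu''(x)=0,\ \lim_{x\to+\infty}A^{\gamma,b}u(x)=0\Big\}$$ if $b>0$; for $u\in D(A^{\gamma,b})$ the function $A^{\gamma,b}u$ is extended continuously to $x=0$. Then $(P_t^{\gamma,b})_{t\ge0}$ is a $C_0$-semigroup of bounded linear operators on $C([0,\infty])$, and $(A^{\gamma,b},D(A^{\gamma,b}))$ is its infinitesimal generator: a function $u\in C([0,\infty])$ belongs to $D(A^{\gamma,b})$ if and only if $\lim_{t\to0^+}\frac{P_t^{\gamma,b}u-u}{t}$ exists in the sup-norm, and in that case this limit equals $A^{\gamma,b}u$. -/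

import Mathlib

open Filter Set MeasureTheory
open scoped Topology NNReal BoundedContinuousFunction

noncomputable section

/-- A `C₀`-semigroup of bounded linear operators on a normed space `X`. -/
structure C0Semigroup (𝕜 X : Type*) [RCLike 𝕜] [NormedAddCommGroup X] [NormedSpace 𝕜 X] where
  /-- the operators of the semigroup -/
  op : ℝ≥0 → X →L[𝕜] X
  op_zero : op 0 = ContinuousLinearMap.id 𝕜 X
  op_add : ∀ s t : ℝ≥0, op (s + t) = (op s).comp (op t)
  tendsto_op : ∀ u : X, Tendsto (fun t : ℝ≥0 => op t u) (𝓝[>] 0) (𝓝 u)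

namespace C0Semigroup

variable {𝕜 X : Type*} [RCLike 𝕜] [NormedAddCommGroup X] [NormedSpace 𝕜 X]

/-- The difference quotient `(T(t)u - u) / t`. -/
def diffQuot (S : C0Semigroup 𝕜 X) (u : X) (t : ℝ≥0) : X :=
  (((t : ℝ) : 𝕜))⁻¹ • (S.op t u - u)

/-- `(T(t)u - u) / t` converges to `v` in the norm of `X` as `t → 0⁺`. -/
def HasGenerator (S : C0Semigroup 𝕜 X) (u v : X) : Prop :=
  Tendsto (S.diffQuot u) (𝓝[>] 0) (𝓝 v)

theorem HasGenerator.add {S : C0Semigroup 𝕜 X} {u u' v v' : X}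
    (h : S.HasGenerator u v) (h' : S.HasGenerator u' v') :
    S.HasGenerator (u + u') (v + v') := by
  refine (Tendsto.add h h').congr fun t => ?_
  simp only [diffQuot, map_add, ← smul_add]
  congr 1
  abel

theorem HasGenerator.smul {S : C0Semigroup 𝕜 X} {u v : X} (c : 𝕜)
    (h : S.HasGenerator u v) : S.HasGenerator (c • u) (c • v) := by
  refine (Tendsto.const_smul h c).congr fun t => ?_
  simp only [diffQuot, map_smul, ← smul_sub]
  rw [smul_comm]

theorem HasGenerator.unique {S : C0Semigroup 𝕜 X} {u v v' : X}
    (h : S.HasGenerator u v) (h' : S.HasGenerator u v') : v = v' :=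
  tendsto_nhds_unique h h'

/-- The infinitesimal generator of a `C₀`-semigroup, an unbounded linear operator: its domain
consists of all `u` for which `lim_{t → 0⁺} (T(t)u - u) / t` exists in the norm of `X`, and it maps
`u` to this limit. -/
def generator (S : C0Semigroup 𝕜 X) : X →ₗ.[𝕜] X where
  domain :=
    { carrier := {u | ∃ v, S.HasGenerator u v}
      add_mem' := fun ⟨v, h⟩ ⟨v', h'⟩ => ⟨v + v', h.add h'⟩
      zero_mem' := ⟨0, by
        refine (tendsto_const_nhds (x := (0 : X))).congr fun t => ?_
        simp [diffQuot]⟩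
      smul_mem' := fun c _ ⟨v, h⟩ => ⟨c • v, h.smul c⟩ }
  toFun :=
    { toFun := fun u => Classical.choose u.2
      map_add' := fun u u' => HasGenerator.unique (Classical.choose_spec (u + u').2)
        ((Classical.choose_spec u.2).add (Classical.choose_spec u'.2))
      map_smul' := fun c u => HasGenerator.unique (Classical.choose_spec (c • u).2)
        ((Classical.choose_spec u.2).smul c) }

end C0Semigroup

/-- The space `C([0,∞])` of continuous functions on `[0,∞[` that converge at infinity, with the
sup-norm. (Such functions are bounded, so the space is a subspace of the bounded continuous
functions.) -/
def CZeroInfty (𝕜 : Type*) [RCLike 𝕜] : Submodule 𝕜 (ℝ≥0 →ᵇ 𝕜) where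
  carrier := {f | ∃ l : 𝕜, Tendsto f atTop (𝓝 l)}
  add_mem' := fun ⟨l, h⟩ ⟨l', h'⟩ => ⟨l + l', h.add h'⟩
  zero_mem' := ⟨0, tendsto_const_nhds⟩
  smul_mem' := fun c _ ⟨l, h⟩ => ⟨c • l, h.const_smul c⟩

/-- `u ∈ C([0,∞])` as a function of a real variable. Only its values on `[0,∞[` are ever used; the
extension to negative arguments (by `u 0`) is irrelevant. -/
def onReal {𝕜 : Type*} [RCLike 𝕜] (u : CZeroInfty 𝕜) (x : ℝ) : 𝕜 :=
  (u : ℝ≥0 →ᵇ 𝕜) x.toNNReal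

section Bessel

variable {𝕜 : Type*} [RCLike 𝕜]

/-- The kernel `p^{γ,b}(x,y,t)` for `b > 0`. -/
def besselKernel (γ b x y t : ℝ) : ℝ :=
  (γ * t) ^ (-(b / γ)) * Real.exp (-((x + y) / (γ * t))) * y ^ (b / γ - 1) *
    ∑' m : ℕ, 1 / ((m.factorial : ℝ) * Real.Gamma (m + b / γ)) *
      ((x ^ m * y ^ m) / (γ ^ (2 * m) * t ^ (2 * m)))

/-- The absolutely continuous part of the kernel `p^{γ,0}(x,y,t)`; the full kernel has in addition
the point mass `exp (-x/(γt)) δ₀(y)`. -/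
def besselKernelZero (γ x y t : ℝ) : ℝ :=
  (γ * t)⁻¹ * Real.exp (-((x + y) / (γ * t))) *
    ∑' m : ℕ, 1 / (((m + 1).factorial : ℝ) * (m.factorial : ℝ)) *
      ((x ^ (m + 1) * y ^ m) / (γ ^ (2 * m + 1) * t ^ (2 * m + 1)))

/-- `P_t^{γ,b} f(x) = ∫₀^∞ p^{γ,b}(x,y,t) f(y) dy` for `t > 0`, and `P_0^{γ,b} f = f`. For `b = 0`
the kernel contains a point mass at `0`, which is integrated explicitly. -/
def besselP (γ b t : ℝ) (f : ℝ → 𝕜) (x : ℝ) : 𝕜 :=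
  if t = 0 then f x
  else if b = 0 then
    Real.exp (-(x / (γ * t))) • f 0 + ∫ y in Ioi (0 : ℝ), besselKernelZero γ x y t • f y
  else ∫ y in Ioi (0 : ℝ), besselKernel γ b x y t • f y

/-- The differential expression `A^{γ,b} u(x) = γ x u''(x) + b u'(x)`, used for `x > 0`. -/
def besselA (γ b : ℝ) (u : ℝ → 𝕜) (x : ℝ) : 𝕜 :=
  (γ * x) • deriv (deriv u) x + b • deriv u x

/-- The domain `D(A^{γ,b})`. -/
def besselDomain (𝕜 : Type*) [RCLike 𝕜] (γ b : ℝ) : Set (CZeroInfty 𝕜) :=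
  {u | ContDiffOn ℝ 2 (onReal u) (Ioi (0 : ℝ)) ∧
    (b = 0 → Tendsto (besselA γ b (onReal u)) (𝓝[>] 0) (𝓝 0)) ∧
    (0 < b → ContDiffOn ℝ 1 (onReal u) (Ici (0 : ℝ)) ∧
      Tendsto (fun x : ℝ => x • deriv (deriv (onReal u)) x) (𝓝[>] 0) (𝓝 0)) ∧
    Tendsto (besselA γ b (onReal u)) atTop (𝓝 0)}

end Bessel

end

/-!
The proof rests on the action of `P_t` on the exponentials `e_l(x) = exp (-l x)`, `l ≥ 0`. Expanding
the kernel as a Poisson mixture of Gamma densities and integrating termwise gives its Laplace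
transform,
`P_t e_l = (1 + lγt)^{-b/γ} e_{l/(1+lγt)}` (`integral_besselDensity_mul_exp_neg`,
`besselOp_expNeg`). In particular the kernel is a probability measure, so each `P_t` is a
contraction. The span `E` of the exponentials is dense in `C([0,∞])` by the Weierstrass theorem in
the variable `exp (-x)` (`dense_expSpan`), so that it suffices to check on `e_l` that `P_t`
preserves `C([0,∞])`, that the semigroup law holds, and that `P_t u → u`; moreover `l ↦ e_l` is a
differentiable curve in `C([0,∞])`, so `E` lies in the domain of the generator `G`, and on `E` the
operators `G` and `A = A^{γ,b}` agree.

`G ⊆ A`: as a dense invariant subspace of the domain, `E` is a core of `G`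
(`C0Semigroup.HasGenerator.exists_core_seq`; a functional annihilating `(1 - G) E` vanishes, by
the equation it satisfies along orbits). It remains to see that `A` is closed. For this the relation
`v = A u` is written in the form of integral equations and boundary conditions that survive uniform
limits (`IsWeakSolution`), and the regularity demanded in `D(A)` is recovered from them.

`A ⊆ G`: since `G` is closed and dissipative, `1 - G` is onto
(`C0Semigroup.exists_hasGenerator_sub_eq`). For `u ∈ D(A)`, the solution `w ∈ D(G) ⊆ D(A)` of
`w - G w = u - A u` equals `u`, because `1 - A` is injective by a maximum principle
(`nonpos_of_besselA_eq_self`); the boundary conditions in `D(A)` are what excludes a maximum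
at `0`.
-/

/-! ### Contraction semigroups and their generators -/

namespace C0Semigroup

variable {𝕜 X : Type*} [RCLike 𝕜] [NormedAddCommGroup X] [NormedSpace 𝕜 X]

/-- A semigroup all of whose operators have norm at most one. -/
def IsContraction (S : C0Semigroup 𝕜 X) : Prop := ∀ t u, ‖S.op t u‖ ≤ ‖u‖

theorem op_add_apply (S : C0Semigroup 𝕜 X) (s t : ℝ≥0) (u : X) :
    S.op (s + t) u = S.op s (S.op t u) := by
  rw [S.op_add]; rfl

theorem op_comm_apply (S : C0Semigroup 𝕜 X) (s t : ℝ≥0) (u : X) :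
    S.op s (S.op t u) = S.op t (S.op s u) := by
  rw [← op_add_apply, add_comm, op_add_apply]

theorem HasGenerator.sub {S : C0Semigroup 𝕜 X} {u u' v v' : X}
    (h : S.HasGenerator u v) (h' : S.HasGenerator u' v') :
    S.HasGenerator (u - u') (v - v') := by
  simpa [sub_eq_add_neg] using h.add (h'.smul (-1))

theorem hasGenerator_generator (S : C0Semigroup 𝕜 X) (u : S.generator.domain) :
    S.HasGenerator u (S.generator u) :=
  Classical.choose_spec u.2

/-- The generator commutes with the semigroup. -/
theorem HasGenerator.op_apply {S : C0Semigroup 𝕜 X} {u v : X} (h : S.HasGenerator u v) (t : ℝ≥0) :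
    S.HasGenerator (S.op t u) (S.op t v) := by
  refine (((S.op t).continuous.tendsto v).comp h).congr fun r => ?_
  simp only [Function.comp, diffQuot, map_smul, map_sub, S.op_comm_apply t r]

theorem continuous_op_apply {S : C0Semigroup 𝕜 X} (hS : S.IsContraction) (u : X) :
    Continuous fun t : ℝ≥0 => S.op t u := by
  have key : ∀ s t : ℝ≥0, s ≤ t → dist (S.op t u) (S.op s u) ≤ ‖S.op (t - s) u - u‖ := by
    intro s t hst
    conv_lhs => rw [← add_tsub_cancel_of_le hst, op_add_apply, dist_eq_norm, ← map_sub]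
    exact hS _ _
  rw [Metric.continuous_iff]
  intro t ε hε
  have h := Metric.tendsto_nhdsWithin_nhds.1 (S.tendsto_op u) ε hε
  obtain ⟨δ, hδ, h⟩ := h
  refine ⟨δ, hδ, fun s hs => ?_⟩
  have small : ∀ r : ℝ≥0, (r : ℝ) < δ → ‖S.op r u - u‖ < ε := by
    intro r hr
    rcases eq_or_ne r 0 with rfl | h0
    · simpa [S.op_zero] using hε
    · rw [← dist_eq_norm]
      exact h (pos_iff_ne_zero.2 h0) (by simpa [NNReal.dist_eq] using hr)
  rw [NNReal.dist_eq] at hs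
  rcases le_total s t with hst | hst
  · rw [dist_comm]
    refine (key s t hst).trans_lt (small _ ?_)
    rw [NNReal.coe_sub hst]
    linarith [neg_abs_le ((s : ℝ) - t)]
  · refine (key t s hst).trans_lt (small _ ?_)
    rw [NNReal.coe_sub hst]
    linarith [le_abs_self ((s : ℝ) - t)]

theorem continuous_op_toNNReal {S : C0Semigroup 𝕜 X} (hS : S.IsContraction) (u : X) :
    Continuous fun r : ℝ => S.op r.toNNReal u :=
  (continuous_op_apply hS u).comp continuous_real_toNNReal

variable [NormedSpace ℝ X] [IsScalarTower ℝ 𝕜 X]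

theorem diffQuot_eq (S : C0Semigroup 𝕜 X) (u : X) (t : ℝ≥0) :
    S.diffQuot u t = (t : ℝ)⁻¹ • (S.op t u - u) := by
  rw [diffQuot, ← RCLike.ofReal_inv, ← RCLike.real_smul_eq_coe_smul]

/-- The generator of a contraction semigroup is dissipative. -/
theorem HasGenerator.norm_le {S : C0Semigroup 𝕜 X} (hS : S.IsContraction) {u v : X}
    (h : S.HasGenerator u v) : ‖u‖ ≤ ‖u - v‖ := by
  refine ge_of_tendsto (tendsto_const_nhds.sub h).norm ?_
  filter_upwards [self_mem_nhdsWithin] with t ht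
  have ht' : (0 : ℝ) < (t : ℝ)⁻¹ := inv_pos.2 ht
  have h1 : u - S.diffQuot u t = (1 + (t : ℝ)⁻¹) • u - (t : ℝ)⁻¹ • S.op t u := by
    rw [diffQuot_eq, smul_sub, add_smul, one_smul]; abel
  have h2 := norm_sub_norm_le ((1 + (t : ℝ)⁻¹) • u) ((t : ℝ)⁻¹ • S.op t u)
  rw [norm_smul, norm_smul, Real.norm_of_nonneg (by positivity),
    Real.norm_of_nonneg ht'.le] at h2
  rw [h1]
  nlinarith [hS t u]

/-- The orbit of a vector in the domain of the generator is differentiable from the right. -/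
theorem HasGenerator.hasDerivWithinAt {S : C0Semigroup 𝕜 X} {u v : X} (h : S.HasGenerator u v)
    {s : ℝ} (hs : 0 ≤ s) :
    HasDerivWithinAt (fun r : ℝ => S.op r.toNNReal u) (S.op s.toNNReal v) (Ici s) s := by
  rw [← hasDerivWithinAt_Ioi_iff_Ici, hasDerivWithinAt_iff_tendsto_slope' (by simp)]
  have h1 : Tendsto (fun r : ℝ => (r - s).toNNReal) (𝓝[>] s) (𝓝[>] 0) := by
    refine tendsto_nhdsWithin_iff.2 ⟨?_, ?_⟩
    · have : Tendsto (fun r : ℝ => (r - s).toNNReal) (𝓝 s) (𝓝 (s - s).toNNReal) :=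
        ((continuous_real_toNNReal.comp (continuous_id.sub continuous_const)).tendsto s)
      simp only [sub_self, Real.toNNReal_zero] at this
      exact this.mono_left nhdsWithin_le_nhds
    · filter_upwards [self_mem_nhdsWithin] with r hr
      simpa using hr
  refine ((h.op_apply s.toNNReal).comp h1).congr' ?_
  filter_upwards [self_mem_nhdsWithin] with r (hr : s < r)
  rw [Function.comp, diffQuot_eq, slope_def_module, ← op_add_apply,
    ← Real.toNNReal_add (by linarith) hs, sub_add_cancel, Real.coe_toNNReal _ (by linarith)]

/-- A mean value inequality along orbits. The bound depends on `u` only through `‖v - w‖`, which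
makes it stable under limits in the graph of the generator. -/
theorem HasGenerator.norm_sub_le {S : C0Semigroup 𝕜 X} (hS : S.IsContraction) {u v : X}
    (h : S.HasGenerator u v) (w : X) {t : ℝ≥0} {C : ℝ} (hC : ∀ s ≤ t, ‖S.op s w - w‖ ≤ C) :
    ‖S.op t u - u - (t : ℝ) • w‖ ≤ (‖v - w‖ + C) * t := by
  have h1 := norm_image_sub_le_of_norm_deriv_right_le_segment (a := 0) (b := (t : ℝ))
    (f := fun r : ℝ => S.op r.toNNReal u - r • w) (f' := fun r => S.op r.toNNReal v - w)
    (C := ‖v - w‖ + C)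
    (((continuous_op_toNNReal hS u).sub (continuous_id.smul continuous_const)).continuousOn)
    (fun x hx => by
      have := (h.hasDerivWithinAt hx.1).fun_sub
        (((hasDerivAt_id x).smul_const w).hasDerivWithinAt (s := Ici x))
      simpa using this)
    (fun x hx => by
      have e : S.op x.toNNReal v - w = S.op x.toNNReal (v - w) + (S.op x.toNNReal w - w) := by
        rw [map_sub]; abel
      rw [e]
      exact (norm_add_le _ _).trans (add_le_add (hS _ _) (hC _
        (Real.toNNReal_le_iff_le_coe.2 hx.2.le)))) t ⟨t.2, le_rfl⟩
  simp only [Real.toNNReal_coe, Real.toNNReal_zero, S.op_zero, zero_smul, sub_zero,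
    ContinuousLinearMap.id_apply] at h1
  rwa [sub_right_comm] at h1

/-- The generator of a contraction semigroup is closed. -/
theorem HasGenerator.of_tendsto {S : C0Semigroup 𝕜 X} (hS : S.IsContraction) {u v : ℕ → X}
    {u₀ v₀ : X} (h : ∀ n, S.HasGenerator (u n) (v n)) (hu : Tendsto u atTop (𝓝 u₀))
    (hv : Tendsto v atTop (𝓝 v₀)) : S.HasGenerator u₀ v₀ := by
  have key : ∀ (t : ℝ≥0) (C : ℝ), (∀ s ≤ t, ‖S.op s v₀ - v₀‖ ≤ C) →
      ‖S.op t u₀ - u₀ - (t : ℝ) • v₀‖ ≤ C * t := by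
    intro t C hC
    have hl : Tendsto (fun n => ‖S.op t (u n) - u n - (t : ℝ) • v₀‖) atTop
        (𝓝 ‖S.op t u₀ - u₀ - (t : ℝ) • v₀‖) :=
      (((((S.op t).continuous.tendsto _).comp hu).sub hu).sub_const _).norm
    have hr : Tendsto (fun n => (‖v n - v₀‖ + C) * t) atTop (𝓝 ((‖v₀ - v₀‖ + C) * t)) :=
      (((hv.sub_const _).norm).add_const _).mul_const _
    simpa using le_of_tendsto_of_tendsto' hl hr fun n => (h n).norm_sub_le hS v₀ hC
  rw [HasGenerator, Metric.tendsto_nhdsWithin_nhds]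
  intro ε hε
  have hc := Metric.continuous_iff.1 (continuous_op_apply hS v₀) 0 (ε / 2) (by positivity)
  obtain ⟨δ, hδ, hc⟩ := hc
  refine ⟨δ, hδ, fun t ht htδ => ?_⟩
  have h1 := key t (ε / 2) fun s hs => by
    have := hc s (lt_of_le_of_lt (by simpa [NNReal.dist_eq] using hs) htδ)
    simpa [S.op_zero, dist_eq_norm] using this.le
  have ht' : (0 : ℝ) < t := ht
  have e : S.diffQuot u₀ t - v₀ = (t : ℝ)⁻¹ • (S.op t u₀ - u₀ - (t : ℝ) • v₀) := by
    rw [diffQuot_eq, smul_sub _ _ ((t : ℝ) • v₀), smul_smul, inv_mul_cancel₀ ht'.ne', one_smul]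
  rw [dist_eq_norm, e, norm_smul, Real.norm_of_nonneg (by positivity)]
  calc (t : ℝ)⁻¹ * _ ≤ (t : ℝ)⁻¹ * (ε / 2 * t) := by gcongr
    _ = ε / 2 := by field_simp
    _ < ε := by linarith

/-- Lumer–Phillips type range condition: if `E` is a dense invariant subspace of the domain of the
generator `G`, then `1 - G` maps `E` onto a dense set. A functional `φ` that annihilates this
image satisfies `(φ ∘ S_t u)' = φ ∘ S_t u` for `u ∈ E`, and a bounded solution vanishes. -/
theorem dense_range_sub {S : C0Semigroup 𝕜 X} (hS : S.IsContraction) {E : Submodule 𝕜 X}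
    (hE : Dense (E : Set X)) (hG : ∀ u ∈ E, ∃ v, S.HasGenerator u v)
    (hinv : ∀ t, ∀ u ∈ E, S.op t u ∈ E) (f : X) :
    f ∈ closure {w | ∃ u ∈ E, ∃ v, S.HasGenerator u v ∧ w = u - v} := by
  set R : Submodule ℝ X :=
    { carrier := {w | ∃ u ∈ E, ∃ v, S.HasGenerator u v ∧ w = u - v}
      add_mem' := by
        rintro _ _ ⟨u, hu, v, h, rfl⟩ ⟨u', hu', v', h', rfl⟩
        exact ⟨u + u', E.add_mem hu hu', v + v', h.add h', by abel⟩
      zero_mem' := ⟨0, E.zero_mem, 0, by simpa using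
        (hG 0 E.zero_mem).choose_spec.smul (0 : 𝕜), by simp⟩
      smul_mem' := by
        rintro c _ ⟨u, hu, v, h, rfl⟩
        refine ⟨(c : 𝕜) • u, E.smul_mem _ hu, (c : 𝕜) • v, h.smul _, ?_⟩
        rw [← smul_sub, RCLike.real_smul_eq_coe_smul (K := 𝕜)] } with hR
  change f ∈ closure (R : Set X)
  by_contra hf
  obtain ⟨φ, c, hφ, hc⟩ := geometric_hahn_banach_closed_point (E := X)
    (s := closure (R : Set X)) R.convex.closure isClosed_closure hf
  have hφ0 : ∀ w ∈ R, φ w = 0 := by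
    intro w hw
    by_contra h0
    have h1 := hφ (((c / φ w)) • w) (subset_closure (R.smul_mem _ hw))
    rw [map_smul, smul_eq_mul, div_mul_cancel₀ _ h0] at h1
    exact lt_irrefl _ h1
  have hE0 : ∀ u ∈ E, φ u = 0 := by
    intro u hu
    obtain ⟨v, hv⟩ := hG u hu
    have hder : ∀ s : ℝ, 0 ≤ s → HasDerivWithinAt
        (fun r : ℝ => Real.exp (-r) * φ (S.op r.toNNReal u)) 0 (Ici s) s := by
      intro s hs
      have h1 := (φ.hasFDerivAt.comp_hasDerivWithinAt s (hv.hasDerivWithinAt hs))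
      have h2 := ((hasDerivAt_id s).neg.exp.hasDerivWithinAt (s := Ici s)).fun_mul h1
      have h3 := hφ0 (S.op s.toNNReal u - S.op s.toNNReal v)
        ⟨_, hinv _ _ hu, _, hv.op_apply _, rfl⟩
      rw [map_sub, sub_eq_zero] at h3
      refine HasDerivWithinAt.congr_deriv h2 ?_
      simp [h3]
    have hconst : ∀ t : ℝ, 0 ≤ t → Real.exp (-t) * φ (S.op t.toNNReal u) = φ u := by
      intro t ht
      have := constant_of_has_deriv_right_zero (a := 0) (b := t)
        (f := fun r : ℝ => Real.exp (-r) * φ (S.op r.toNNReal u))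
        ((Real.continuous_exp.comp continuous_neg).mul
          (φ.continuous.comp (continuous_op_toNNReal hS u))).continuousOn
        (fun x hx => hder x hx.1) t ⟨ht, le_rfl⟩
      simpa [S.op_zero] using this
    have hlim : Tendsto (fun t : ℝ => Real.exp (-t) * (‖φ‖ * ‖u‖)) atTop (𝓝 (0 * (‖φ‖ * ‖u‖))) :=
      (Real.tendsto_exp_neg_atTop_nhds_zero).mul_const _
    rw [zero_mul] at hlim
    have : ‖φ u‖ ≤ 0 := by
      refine ge_of_tendsto hlim ?_
      filter_upwards [eventually_ge_atTop 0] with t ht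
      rw [← hconst t ht, norm_mul, Real.norm_of_nonneg (Real.exp_pos _).le]
      gcongr
      exact (φ.le_opNorm _).trans (by gcongr; exact hS _ _)
    exact norm_le_zero_iff.1 this
  have hφz : ∀ x, φ x = 0 := fun x =>
    closure_minimal (t := {x | φ x = 0}) hE0 (isClosed_eq φ.continuous continuous_const) (hE x)
  have := hφ 0 (subset_closure R.zero_mem)
  rw [hφz] at this hc
  exact lt_asymm this hc

/-- A dense invariant subspace of the domain is a core of the generator. -/
theorem HasGenerator.exists_core_seq {S : C0Semigroup 𝕜 X} (hS : S.IsContraction)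
    {E : Submodule 𝕜 X} (hE : Dense (E : Set X)) (hG : ∀ u ∈ E, ∃ v, S.HasGenerator u v)
    (hinv : ∀ t, ∀ u ∈ E, S.op t u ∈ E) {u v : X} (h : S.HasGenerator u v) :
    ∃ u' v' : ℕ → X, (∀ n, u' n ∈ E) ∧ (∀ n, S.HasGenerator (u' n) (v' n)) ∧
      Tendsto u' atTop (𝓝 u) ∧ Tendsto v' atTop (𝓝 v) := by
  obtain ⟨w, hw, hlim⟩ := mem_closure_iff_seq_limit.1 (dense_range_sub hS hE hG hinv (u - v))
  choose u' hu' v' hv' hw using hw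
  have hu : Tendsto u' atTop (𝓝 u) := by
    rw [tendsto_iff_norm_sub_tendsto_zero] at hlim ⊢
    refine squeeze_zero (fun _ => norm_nonneg _) (fun n => ?_) hlim
    have := ((hv' n).sub h).norm_le hS
    rwa [sub_sub_sub_comm, ← hw n] at this
  refine ⟨u', v', hu', hv', hu, ?_⟩
  have := hu.sub hlim
  rw [sub_sub_cancel] at this
  exact this.congr fun n => by rw [hw n, sub_sub_cancel]

/-- `1 - G` is onto for the generator `G` of a contraction semigroup. -/
theorem exists_hasGenerator_sub_eq [CompleteSpace X] {S : C0Semigroup 𝕜 X} (hS : S.IsContraction)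
    {E : Submodule 𝕜 X} (hE : Dense (E : Set X)) (hG : ∀ u ∈ E, ∃ v, S.HasGenerator u v)
    (hinv : ∀ t, ∀ u ∈ E, S.op t u ∈ E) (f : X) : ∃ u, S.HasGenerator u (u - f) := by
  obtain ⟨w, hw, hlim⟩ := mem_closure_iff_seq_limit.1 (dense_range_sub hS hE hG hinv f)
  choose u hu v hv hw using hw
  have hc : CauchySeq u := by
    rw [Metric.cauchySeq_iff]
    intro ε hε
    obtain ⟨N, hN⟩ := Metric.cauchySeq_iff.1 hlim.cauchySeq ε hε
    refine ⟨N, fun m hm n hn => lt_of_le_of_lt ?_ (hN m hm n hn)⟩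
    rw [dist_eq_norm, dist_eq_norm, hw, hw]
    have := ((hv m).sub (hv n)).norm_le hS
    rwa [sub_sub_sub_comm] at this
  obtain ⟨u₀, hu₀⟩ := cauchySeq_tendsto_of_complete hc
  refine ⟨u₀, HasGenerator.of_tendsto hS hv hu₀ ((hu₀.sub hlim).congr fun n => ?_)⟩
  rw [hw n, sub_sub_cancel]

end C0Semigroup

/-! ### The space `C([0,∞])` -/

noncomputable section Space

variable {𝕜 : Type*} [RCLike 𝕜]

instance CZeroInfty.instNormedSpaceReal : NormedSpace ℝ (CZeroInfty 𝕜) :=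
  Submodule.normedSpace (CZeroInfty 𝕜)

theorem norm_onReal_le (u : CZeroInfty 𝕜) (x : ℝ) : ‖onReal u x‖ ≤ ‖u‖ :=
  (u : ℝ≥0 →ᵇ 𝕜).norm_coe_le_norm _

/-- Evaluation at a point, as a continuous linear functional on `C([0,∞])`. -/
def evalCLM (𝕜 : Type*) [RCLike 𝕜] (x : ℝ) : CZeroInfty 𝕜 →L[𝕜] 𝕜 :=
  LinearMap.mkContinuous
    { toFun := fun u => onReal u x
      map_add' := fun _ _ => rfl
      map_smul' := fun _ _ => rfl } 1 fun u => by
      rw [one_mul]; exact norm_onReal_le u x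

@[simp]
theorem evalCLM_apply (x : ℝ) (u : CZeroInfty 𝕜) : evalCLM 𝕜 x u = onReal u x := rfl

@[simp]
theorem onReal_add (u v : CZeroInfty 𝕜) (x : ℝ) : onReal (u + v) x = onReal u x + onReal v x := rfl

@[simp]
theorem onReal_sub (u v : CZeroInfty 𝕜) (x : ℝ) : onReal (u - v) x = onReal u x - onReal v x := rfl

@[simp]
theorem onReal_zero (x : ℝ) : onReal (0 : CZeroInfty 𝕜) x = 0 := rfl

@[simp]
theorem onReal_smul (c : 𝕜) (u : CZeroInfty 𝕜) (x : ℝ) : onReal (c • u) x = c * onReal u x := rfl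

@[simp]
theorem onReal_real_smul (c : ℝ) (u : CZeroInfty 𝕜) (x : ℝ) :
    onReal (c • u) x = c • onReal u x := rfl

theorem norm_le_of_onReal {u : CZeroInfty 𝕜} {C : ℝ} (hC : 0 ≤ C)
    (h : ∀ x, 0 ≤ x → ‖onReal u x‖ ≤ C) : ‖u‖ ≤ C := by
  refine (BoundedContinuousFunction.norm_le hC).2 fun x => ?_
  simpa [onReal] using h x x.2

theorem ext_onReal {u v : CZeroInfty 𝕜} (h : ∀ x, 0 ≤ x → onReal u x = onReal v x) : u = v := by
  rw [← sub_eq_zero, ← norm_le_zero_iff]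
  exact norm_le_of_onReal le_rfl fun x hx => by simp [h x hx]

theorem real_smul_eq_ofReal_smul (c : ℝ) (u : CZeroInfty 𝕜) : c • u = (c : 𝕜) • u :=
  ext_onReal fun x _ => by rw [onReal_real_smul, onReal_smul, RCLike.real_smul_eq_coe_mul]

theorem continuous_onReal (u : CZeroInfty 𝕜) : Continuous (onReal u) :=
  (u : ℝ≥0 →ᵇ 𝕜).continuous.comp continuous_real_toNNReal

theorem exists_tendsto_onReal (u : CZeroInfty 𝕜) : ∃ l, Tendsto (onReal u) atTop (𝓝 l) := by
  obtain ⟨l, hl⟩ := u.2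
  exact ⟨l, hl.comp Real.tendsto_toNNReal_atTop⟩

/-- A continuous function on `[0,∞[` with a limit at infinity is an element of `C([0,∞])`. -/
theorem exists_onReal_eq {f : ℝ → 𝕜} (hf : ContinuousOn f (Ici 0)) {l : 𝕜}
    (hl : Tendsto f atTop (𝓝 l)) : ∃ u : CZeroInfty 𝕜, ∀ x, 0 ≤ x → onReal u x = f x := by
  obtain ⟨C, hC⟩ : ∃ C, ∀ x, 0 ≤ x → ‖f x‖ ≤ C := by
    obtain ⟨N, hN⟩ := eventually_atTop.1 (hl.norm.eventually_lt_const (lt_add_one ‖l‖))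
    obtain ⟨C, hC⟩ := (isCompact_Icc (a := (0 : ℝ)) (b := N)).exists_bound_of_continuousOn
      (hf.mono Icc_subset_Ici_self)
    refine ⟨max C (‖l‖ + 1), fun x hx => ?_⟩
    rcases le_total x N with h | h
    · exact (hC x ⟨hx, h⟩).trans (le_max_left _ _)
    · exact (hN x h).le.trans (le_max_right _ _)
  have hc : Continuous fun x : ℝ≥0 => f x :=
    hf.comp_continuous NNReal.continuous_coe fun x => x.2
  refine ⟨⟨BoundedContinuousFunction.ofNormedAddCommGroup (fun x : ℝ≥0 => f x) hc C
    fun x => hC x x.2, l, hl.comp (NNReal.tendsto_coe_atTop.2 tendsto_id)⟩, fun x hx => ?_⟩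
  simp [onReal, hx]

instance CZeroInfty.instCompleteSpace : CompleteSpace (CZeroInfty 𝕜) := by
  suffices IsClosed (CZeroInfty 𝕜 : Set (ℝ≥0 →ᵇ 𝕜)) from this.completeSpace_coe
  refine isClosed_of_closure_subset fun f hf => ?_
  change ∃ l, Tendsto f atTop (𝓝 l)
  rw [← cauchy_map_iff_exists_tendsto, Metric.cauchy_iff]
  refine ⟨inferInstance, fun ε hε => ?_⟩
  obtain ⟨g, ⟨l, hg⟩, hfg⟩ := Metric.mem_closure_iff.1 hf (ε / 4) (by positivity)
  refine ⟨f '' {x | dist (g x) l < ε / 4},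
    image_mem_map (Metric.tendsto_nhds.1 hg (ε / 4) (by positivity)), ?_⟩
  rintro _ ⟨x, hx, rfl⟩ _ ⟨y, hy, rfl⟩
  have h1 := (BoundedContinuousFunction.dist_coe_le_dist (f := f) (g := g) x).trans_lt hfg
  have h2 := (BoundedContinuousFunction.dist_coe_le_dist (f := f) (g := g) y).trans_lt hfg
  have h3 := dist_triangle4 (f x) (g x) (g y) (f y)
  have h4 := dist_triangle_right (g x) (g y) l
  rw [dist_comm (g y) (f y)] at h3
  simp only [Set.mem_ofPred_eq] at hx hy
  linarith

/-! ### The exponentials `x ↦ exp (-l x)` in `C([0,∞])` -/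

theorem tendsto_mul_exp_neg_atTop {l : ℝ} (hl : 0 < l) (p q : ℝ) :
    Tendsto (fun x : ℝ => (p * x + q) * Real.exp (-(l * x))) atTop (𝓝 0) := by
  have h1 : Tendsto (fun x : ℝ => x ^ (1 : ℝ) * Real.exp (-l * x)) atTop (𝓝 0) :=
    tendsto_rpow_mul_exp_neg_mul_atTop_nhds_zero 1 l hl
  have h0 : Tendsto (fun x : ℝ => x ^ (0 : ℝ) * Real.exp (-l * x)) atTop (𝓝 0) :=
    tendsto_rpow_mul_exp_neg_mul_atTop_nhds_zero 0 l hl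
  have := (h1.const_mul p).add (h0.const_mul q)
  simp only [mul_zero, add_zero] at this
  refine this.congr fun x => ?_
  simp only [Real.rpow_one, Real.rpow_zero, neg_mul]
  ring

theorem exists_onReal_eq_exp (𝕜 : Type*) [RCLike 𝕜] {l : ℝ} (hl : 0 ≤ l) :
    ∃ u : CZeroInfty 𝕜, ∀ x, 0 ≤ x → onReal u x = ((Real.exp (-(l * x)) : ℝ) : 𝕜) := by
  have hc : Continuous fun x : ℝ => ((Real.exp (-(l * x)) : ℝ) : 𝕜) := by fun_prop
  rcases hl.eq_or_lt with rfl | hl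
  · exact exists_onReal_eq (l := 1) hc.continuousOn (by simp)
  · have := (RCLike.continuous_ofReal (K := 𝕜)).tendsto 0 |>.comp (tendsto_mul_exp_neg_atTop hl 0 1)
    exact exists_onReal_eq hc.continuousOn (by simpa [Function.comp_def] using this)

/-- The exponential function `x ↦ exp (-l x)` as an element of `C([0,∞])`, for `l ≥ 0`. Negative
`l` are replaced by `0`. -/
def expNeg (𝕜 : Type*) [RCLike 𝕜] (l : ℝ) : CZeroInfty 𝕜 :=
  (exists_onReal_eq_exp 𝕜 (le_max_right l 0)).choose

theorem onReal_expNeg {l : ℝ} (hl : 0 ≤ l) {x : ℝ} (hx : 0 ≤ x) :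
    onReal (expNeg 𝕜 l) x = ((Real.exp (-(l * x)) : ℝ) : 𝕜) := by
  rw [expNeg, (exists_onReal_eq_exp 𝕜 (le_max_right l 0)).choose_spec x hx, max_eq_left hl]

theorem abs_exp_neg_sub_le {l m x : ℝ} (hl : 0 < l) (hm : |m| ≤ l / 2) (hx : 0 ≤ x) :
    |Real.exp (-((l + m) * x)) - Real.exp (-(l * x)) + m * (x * Real.exp (-(l * x)))| ≤
      8 / l ^ 2 * m ^ 2 := by
  have h1 : |Real.exp (-(m * x)) - 1 + m * x| ≤ (m * x) ^ 2 * Real.exp (l / 2 * x) := by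
    have h := Complex.norm_exp_sub_sum_le_norm_mul_exp ((-(m * x) : ℝ) : ℂ) 2
    rw [← Complex.ofReal_exp] at h
    simp only [Finset.sum_range_succ, Finset.sum_range_zero, Nat.factorial, zero_add, pow_zero,
      pow_one, Nat.cast_one, div_one, mul_one] at h
    rw [← Complex.ofReal_one, ← Complex.ofReal_add, ← Complex.ofReal_sub, Complex.norm_real,
      Complex.norm_real, Real.norm_eq_abs, Real.norm_eq_abs, sq_abs, neg_sq, abs_neg, abs_mul,
      abs_of_nonneg hx] at h
    have h' : Real.exp (-(m * x)) - (1 + -(m * x)) = Real.exp (-(m * x)) - 1 + m * x := by ring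
    rw [h'] at h
    exact h.trans (by gcongr)
  have h2 := Real.quadratic_le_exp_of_nonneg (x := l / 2 * x) (by positivity)
  have h3 : Real.exp (-((l + m) * x)) - Real.exp (-(l * x)) + m * (x * Real.exp (-(l * x))) =
      Real.exp (-(l * x)) * (Real.exp (-(m * x)) - 1 + m * x) := by
    rw [add_mul, neg_add, Real.exp_add]; ring
  rw [h3, abs_mul, abs_of_pos (Real.exp_pos _)]
  have h4 : Real.exp (-(l * x)) * Real.exp (l / 2 * x) * Real.exp (l / 2 * x) = 1 := by
    rw [← Real.exp_add, ← Real.exp_add, ← Real.exp_zero]; congr 1; ring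
  have h5 : x ^ 2 ≤ 8 / l ^ 2 * Real.exp (l / 2 * x) := by
    rw [div_mul_eq_mul_div, le_div_iff₀ (by positivity)]
    nlinarith [mul_nonneg hl.le hx]
  calc Real.exp (-(l * x)) * |Real.exp (-(m * x)) - 1 + m * x|
      ≤ Real.exp (-(l * x)) * ((m * x) ^ 2 * Real.exp (l / 2 * x)) := by gcongr
    _ = m ^ 2 * (Real.exp (-(l * x)) * Real.exp (l / 2 * x)) * x ^ 2 := by ring
    _ ≤ m ^ 2 * (Real.exp (-(l * x)) * Real.exp (l / 2 * x)) *
        (8 / l ^ 2 * Real.exp (l / 2 * x)) := by gcongr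
    _ = 8 / l ^ 2 * m ^ 2 *
        (Real.exp (-(l * x)) * Real.exp (l / 2 * x) * Real.exp (l / 2 * x)) := by ring
    _ = 8 / l ^ 2 * m ^ 2 := by rw [h4, mul_one]

/-- The curve `l ↦ exp (-l ·)` is differentiable in `C([0,∞])` at each `l > 0`, with derivative
`x ↦ -x exp (-l x)`. -/
theorem exists_hasDerivAt_expNeg (𝕜 : Type*) [RCLike 𝕜] {l : ℝ} (hl : 0 < l) :
    ∃ d : CZeroInfty 𝕜, (∀ x, 0 ≤ x → onReal d x = ((-(x * Real.exp (-(l * x))) : ℝ) : 𝕜)) ∧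
      HasDerivAt (expNeg 𝕜) d l := by
  obtain ⟨d, hd⟩ : ∃ d : CZeroInfty 𝕜, ∀ x, 0 ≤ x →
      onReal d x = ((-(x * Real.exp (-(l * x))) : ℝ) : 𝕜) := by
    have hc : Continuous fun x : ℝ => ((-(x * Real.exp (-(l * x))) : ℝ) : 𝕜) := by fun_prop
    have := (RCLike.continuous_ofReal (K := 𝕜)).tendsto 0 |>.comp
      (tendsto_mul_exp_neg_atTop hl (-1) 0)
    exact exists_onReal_eq hc.continuousOn (by simpa [Function.comp_def] using this)
  refine ⟨d, hd, ?_⟩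
  rw [hasDerivAt_iff_isLittleO_nhds_zero]
  have hO : (fun m : ℝ => expNeg 𝕜 (l + m) - expNeg 𝕜 l - m • d) =O[𝓝 0] fun m : ℝ => m ^ 2 := by
    refine Asymptotics.IsBigO.of_bound (8 / l ^ 2) ?_
    filter_upwards [Metric.closedBall_mem_nhds (0 : ℝ) (half_pos hl)] with m hm
    have hm : |m| ≤ l / 2 := by simpa using hm
    rw [Real.norm_of_nonneg (sq_nonneg m)]
    refine norm_le_of_onReal (by positivity) fun x hx => ?_
    rw [onReal_sub, onReal_sub, onReal_real_smul, onReal_expNeg (by linarith [neg_abs_le m]) hx,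
      onReal_expNeg hl.le hx, hd x hx, RCLike.real_smul_eq_coe_mul, ← RCLike.ofReal_sub,
      ← RCLike.ofReal_mul, ← RCLike.ofReal_sub, RCLike.norm_ofReal]
    simpa using abs_exp_neg_sub_le hl hm hx
  exact hO.trans_isLittleO (Asymptotics.isLittleO_pow_id one_lt_two)

/-- The linear span of the exponentials. -/
def expSpan (𝕜 : Type*) [RCLike 𝕜] : Submodule 𝕜 (CZeroInfty 𝕜) :=
  Submodule.span 𝕜 (expNeg 𝕜 '' Ici 0)

theorem expNeg_mem_expSpan {l : ℝ} (hl : 0 ≤ l) : expNeg 𝕜 l ∈ expSpan 𝕜 :=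
  Submodule.subset_span ⟨l, hl, rfl⟩

theorem exists_mem_expSpan_polynomial (p : Polynomial ℝ) :
    ∃ u ∈ expSpan 𝕜, ∀ x, 0 ≤ x → onReal u x = ((p.eval (Real.exp (-x)) : ℝ) : 𝕜) := by
  induction p using Polynomial.induction_on' with
  | add p q hp hq =>
    obtain ⟨u, hu, hp⟩ := hp
    obtain ⟨v, hv, hq⟩ := hq
    exact ⟨u + v, Submodule.add_mem _ hu hv, fun x hx => by simp [hp x hx, hq x hx]⟩
  | monomial n a =>
    refine ⟨(a : 𝕜) • expNeg 𝕜 n, Submodule.smul_mem _ _ (expNeg_mem_expSpan n.cast_nonneg),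
      fun x hx => ?_⟩
    rw [onReal_smul, onReal_expNeg n.cast_nonneg hx, Polynomial.eval_monomial, ← Real.exp_nat_mul]
    simp

/-- The exponentials span a dense subspace: under `w = exp (-x)` this is the Weierstrass
approximation theorem on `[0,1]`. -/
theorem dense_expSpan (𝕜 : Type*) [RCLike 𝕜] : Dense (expSpan 𝕜 : Set (CZeroInfty 𝕜)) := by
  intro u
  obtain ⟨l, hl⟩ := exists_tendsto_onReal u
  -- `g (exp (-x)) = u x` and `g 0 = u(∞)`; the values at negative arguments do not matter.
  set g : ℝ → 𝕜 := Function.update (fun w => onReal u (-Real.log w)) 0 l with hgdef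
  have hg : Continuous g := by
    rw [continuous_iff_continuousAt]
    intro w
    rcases eq_or_ne w 0 with rfl | hw
    · rw [hgdef, continuousAt_update_same]
      exact hl.comp (tendsto_neg_atBot_atTop.comp Real.tendsto_log_nhdsNE_zero)
    · rw [hgdef, continuousAt_update_of_ne hw]
      exact (continuous_onReal u).continuousAt.comp (Real.continuousAt_log hw).neg
  have hgx : ∀ x, g (Real.exp (-x)) = onReal u x := fun x => by
    simp [hgdef]
  let G : C(unitInterval, 𝕜) := ⟨fun w => g w, hg.comp continuous_subtype_val⟩
  rw [Metric.mem_closure_iff]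
  intro ε hε
  obtain ⟨n, hn⟩ := (Metric.tendsto_nhds.1 (bernsteinApproximation_uniform G) (ε / 2)
    (by positivity)).exists
  choose v hv hvx using fun k : Fin (n + 1) => exists_mem_expSpan_polynomial (𝕜 := 𝕜)
    (bernsteinPolynomial ℝ n k)
  refine ⟨∑ k, G (bernstein.z k) • v k,
    Submodule.sum_mem _ fun k _ => Submodule.smul_mem _ _ (hv k), ?_⟩
  rw [dist_eq_norm]
  refine lt_of_le_of_lt (norm_le_of_onReal (by positivity) fun x hx => ?_) (half_lt_self hε)
  have hw : Real.exp (-x) ∈ unitInterval :=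
    ⟨(Real.exp_pos _).le, Real.exp_le_one_iff.2 (by linarith)⟩
  have h1 := (ContinuousMap.dist_apply_le_dist (f := bernsteinApproximation n G) (g := G)
    ⟨_, hw⟩).trans_lt hn
  have h2 : onReal (∑ k, G (bernstein.z k) • v k) x = bernsteinApproximation n G ⟨_, hw⟩ := by
    rw [bernsteinApproximation.apply, ← evalCLM_apply, map_sum]
    refine Finset.sum_congr rfl fun k _ => ?_
    rw [map_smul, evalCLM_apply, hvx k x hx, smul_eq_mul, mul_comm, RCLike.real_smul_eq_coe_mul]
    rfl
  have h3 : G ⟨_, hw⟩ = onReal u x := hgx x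
  rw [h3, ← h2, dist_comm, dist_eq_norm] at h1
  exact h1.le

end Space

/-! ### Laplace transform of the kernel -/

section Laplace

theorem integrableOn_rpow_mul_exp_neg {a r : ℝ} (ha : 0 < a) (hr : 0 < r) :
    IntegrableOn (fun y : ℝ => y ^ (a - 1) * Real.exp (-(r * y))) (Ioi 0) := by
  refine not_imp_comm.1 integral_undef ?_
  rw [Real.integral_rpow_mul_exp_neg_mul_Ioi ha hr]
  have := Real.Gamma_pos_of_pos ha
  positivity

/-- Termwise integration of a series of Gamma densities with nonnegative coefficients. -/
theorem integral_tsum_rpow_mul_exp_neg {K a : ℕ → ℝ} {r s : ℝ} (hr : 0 < r) (hK : ∀ m, 0 ≤ K m)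
    (ha : ∀ m, 0 < a m) (hs : HasSum (fun m => K m * ((1 / r) ^ a m * Real.Gamma (a m))) s) :
    IntegrableOn (fun y : ℝ => ∑' m, K m * (y ^ (a m - 1) * Real.exp (-(r * y)))) (Ioi 0) ∧
    ∫ y in Ioi (0 : ℝ), ∑' m, K m * (y ^ (a m - 1) * Real.exp (-(r * y))) = s := by
  have hint : ∀ m, ∫ y in Ioi (0 : ℝ), K m * (y ^ (a m - 1) * Real.exp (-(r * y))) =
      K m * ((1 / r) ^ a m * Real.Gamma (a m)) := fun m => by
    rw [integral_const_mul, Real.integral_rpow_mul_exp_neg_mul_Ioi (ha m) hr]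
  have hnorm : ∀ m, ∫ y in Ioi (0 : ℝ), ‖K m * (y ^ (a m - 1) * Real.exp (-(r * y)))‖ =
      K m * ((1 / r) ^ a m * Real.Gamma (a m)) := fun m => by
    rw [← hint m]
    refine setIntegral_congr_fun measurableSet_Ioi fun y (hy : 0 < y) => ?_
    have := hK m
    exact Real.norm_of_nonneg (by positivity)
  have hsum := hasSum_integral_of_summable_integral_norm (μ := volume.restrict (Ioi (0 : ℝ)))
    (F := fun m y => K m * (y ^ (a m - 1) * Real.exp (-(r * y))))
    (fun m => (integrableOn_rpow_mul_exp_neg (ha m) hr).const_mul (K m))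
    (by simpa only [hnorm] using hs.summable)
  simp only [hint] at hsum
  have heq := hsum.unique hs
  refine ⟨?_, heq⟩
  rcases eq_or_ne s 0 with rfl | h0
  · have hpos : ∀ m, 0 < (1 / r) ^ a m * Real.Gamma (a m) := fun m => by
      have := Real.Gamma_pos_of_pos (ha m)
      positivity
    have hz := (hasSum_zero_iff_of_nonneg fun m => mul_nonneg (hK m) (hpos m).le).1 hs
    have hK0 : ∀ m, K m = 0 := fun m =>
      (mul_eq_zero.1 (congrFun hz m)).resolve_right (hpos m).ne'
    simp [hK0]
  · exact not_imp_comm.1 integral_undef (heq ▸ h0)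

/-- The density on `]0,∞[` of the kernel `p^{γ,b}(x,·,t)`. -/
noncomputable def besselDensity (γ b x y t : ℝ) : ℝ :=
  if b = 0 then besselKernelZero γ x y t else besselKernel γ b x y t

/-- The mass of the kernel `p^{γ,b}(x,·,t)` at `0`. -/
noncomputable def besselAtom (γ b x t : ℝ) : ℝ :=
  if b = 0 then Real.exp (-(x / (γ * t))) else 0

theorem besselAtom_nonneg (γ b x t : ℝ) : 0 ≤ besselAtom γ b x t := by
  unfold besselAtom
  split_ifs <;> positivity

theorem besselP_eq {𝕜 : Type*} [RCLike 𝕜] (γ b : ℝ) {t : ℝ} (ht : t ≠ 0) (f : ℝ → 𝕜) (x : ℝ) :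
    besselP γ b t f x =
      besselAtom γ b x t • f 0 + ∫ y in Ioi (0 : ℝ), besselDensity γ b x y t • f y := by
  rw [besselP, if_neg ht]
  unfold besselAtom besselDensity
  split_ifs
  · rfl
  · rw [zero_smul, zero_add]

/-- The density is a mixture of Gamma densities with Poisson weights. A factor `exp (-l y)` only
changes the rate `1 / (γt)` of the components to `1 / (γt) + l`, and their total masses then form an
exponential series. For `b = 0` the missing zeroth Poisson weight is the atom at `0`. -/
theorem exists_besselDensity_series {γ b x t : ℝ} (hγ : 0 < γ) (hb : 0 ≤ b) (hx : 0 ≤ x)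
    (ht : 0 < t) : ∃ K a : ℕ → ℝ, (∀ m, 0 ≤ K m) ∧ (∀ m, 0 < a m) ∧ ∀ l, 0 ≤ l →
      (∀ y, 0 < y → besselDensity γ b x y t * Real.exp (-(l * y)) =
        ∑' m, K m * (y ^ (a m - 1) * Real.exp (-((1 / (γ * t) + l) * y)))) ∧
      HasSum (fun m => K m * ((1 / (1 / (γ * t) + l)) ^ a m * Real.Gamma (a m)))
        ((1 + l * (γ * t)) ^ (-(b / γ)) * Real.exp (-(l / (1 + l * (γ * t)) * x)) -
          besselAtom γ b x t) := by
  have hc : 0 < γ * t := mul_pos hγ ht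
  have hexp : ∀ l y : ℝ, Real.exp (-((x + y) / (γ * t))) * Real.exp (-(l * y)) =
      Real.exp (-(x / (γ * t))) * Real.exp (-((1 / (γ * t) + l) * y)) := fun l y => by
    rw [← Real.exp_add, ← Real.exp_add]; congr 1; ring
  have hmean : ∀ l, 0 ≤ l → 1 / (1 / (γ * t) + l) = γ * t / (1 + l * (γ * t)) := fun l hl => by
    field_simp
  have hpois : ∀ l, 0 ≤ l → Real.exp (-(x / (γ * t))) *
      Real.exp (x / (γ * t) * (1 / (1 + l * (γ * t)))) =
      Real.exp (-(l / (1 + l * (γ * t)) * x)) := fun l hl => by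
    rw [← Real.exp_add]; congr 1
    have : 0 < 1 + l * (γ * t) := by positivity
    field_simp; ring
  rcases hb.eq_or_lt with rfl | hb
  · refine ⟨fun m => (γ * t)⁻¹ * Real.exp (-(x / (γ * t))) *
      (1 / (((m + 1).factorial : ℝ) * (m.factorial : ℝ)) *
        (x ^ (m + 1) / (γ ^ (2 * m + 1) * t ^ (2 * m + 1)))), fun m => m + 1,
      fun m => by positivity, fun m => by positivity, fun l hl => ⟨fun y hy => ?_, ?_⟩⟩
    · rw [besselDensity, if_pos rfl, besselKernelZero, mul_right_comm, mul_assoc (γ * t)⁻¹, hexp,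
        ← tsum_mul_left]
      refine tsum_congr fun m => ?_
      rw [add_sub_cancel_right, Real.rpow_natCast]
      ring
    · set z : ℝ := x / (γ * t) * (1 / (1 + l * (γ * t))) with hz
      have h1 : HasSum (fun m : ℕ => z ^ (m + 1) / ((m + 1).factorial : ℝ)) (Real.exp z - 1) := by
        have := NormedSpace.expSeries_div_hasSum_exp z
        rw [← Real.exp_eq_exp_ℝ] at this
        simpa using (hasSum_nat_add_iff' 1).2 this
      have h2 := h1.mul_left (Real.exp (-(x / (γ * t))))
      rw [mul_sub, hpois l hl, mul_one] at h2
      convert! h2 using 1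
      · funext m
        dsimp only
        have hl' : 0 < 1 + l * (γ * t) := by positivity
        rw [hmean l hl, ← Nat.cast_succ, Real.rpow_natCast, Nat.cast_succ,
          Real.Gamma_nat_eq_factorial, hz]
        have hm : (m.factorial : ℝ) ≠ 0 := by positivity
        have e1 : γ ^ (2 * m + 1) * t ^ (2 * m + 1) * (γ * t) =
            (γ * t) ^ (m + 1) * (γ * t) ^ (m + 1) := by
          ring
        have e2 : (γ * t)⁻¹ * (x ^ (m + 1) / (γ ^ (2 * m + 1) * t ^ (2 * m + 1))) =
            x ^ (m + 1) / ((γ * t) ^ (m + 1) * (γ * t) ^ (m + 1)) := by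
          rw [← e1]; field_simp
        calc _ = ((γ * t)⁻¹ * (x ^ (m + 1) / (γ ^ (2 * m + 1) * t ^ (2 * m + 1)))) *
              (Real.exp (-(x / (γ * t))) / ((m + 1).factorial : ℝ)) *
              (γ * t / (1 + l * (γ * t))) ^ (m + 1) := by field_simp
          _ = _ := by rw [e2]; simp only [mul_pow, div_pow, one_pow]; field_simp
      · simp [besselAtom]
  · have hν : 0 < b / γ := div_pos hb hγ
    set ν := b / γ with hνdef
    have hG : ∀ m : ℕ, 0 < Real.Gamma (m + ν) := fun m => Real.Gamma_pos_of_pos (by positivity)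
    refine ⟨fun m => (γ * t) ^ (-ν) * Real.exp (-(x / (γ * t))) *
      (1 / ((m.factorial : ℝ) * Real.Gamma (m + ν)) * (x ^ m / (γ ^ (2 * m) * t ^ (2 * m)))),
      fun m => m + ν, fun m => by have := hG m; positivity,
      fun m => by positivity, fun l hl => ⟨fun y hy => ?_, ?_⟩⟩
    · rw [besselDensity, if_neg hb.ne', besselKernel, ← hνdef, mul_right_comm,
        mul_right_comm _ (y ^ (ν - 1)), mul_assoc ((γ * t) ^ (-ν)), hexp, ← tsum_mul_left]
      refine tsum_congr fun m => ?_
      rw [add_sub_assoc, Real.rpow_add hy, Real.rpow_natCast]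
      ring
    · have hl' : 0 < 1 + l * (γ * t) := by positivity
      set z : ℝ := x / (γ * t) * (1 / (1 + l * (γ * t))) with hz
      have h1 := NormedSpace.expSeries_div_hasSum_exp z
      rw [← Real.exp_eq_exp_ℝ] at h1
      have h2 := h1.mul_left ((1 + l * (γ * t)) ^ (-ν) * Real.exp (-(x / (γ * t))))
      rw [mul_assoc, hpois l hl] at h2
      convert! h2 using 1
      · funext m
        dsimp only
        have := (hG m).ne'
        have hm : (m.factorial : ℝ) ≠ 0 := by positivity
        rw [hmean l hl, Real.rpow_add (by positivity), Real.rpow_natCast,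
          Real.div_rpow hc.le hl'.le, Real.rpow_neg hc.le, Real.rpow_neg hl'.le, hz]
        have e1 : γ ^ (2 * m) * t ^ (2 * m) = (γ * t) ^ m * (γ * t) ^ m := by ring
        have e3 := (Real.rpow_pos_of_pos hc ν).ne'
        have e4 := (Real.rpow_pos_of_pos hl' ν).ne'
        rw [e1]
        simp only [mul_pow, div_pow, one_pow]
        field_simp
      · simp [besselAtom, hb.ne']

variable {γ b x t : ℝ}

theorem besselDensity_nonneg (hγ : 0 < γ) (hb : 0 ≤ b) (hx : 0 ≤ x) (ht : 0 < t) {y : ℝ}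
    (hy : 0 < y) : 0 ≤ besselDensity γ b x y t := by
  obtain ⟨K, a, hK, ha, h⟩ := exists_besselDensity_series hγ hb hx ht
  have := (h 0 le_rfl).1 y hy
  simp only [zero_mul, neg_zero, Real.exp_zero, mul_one] at this
  rw [this]
  exact tsum_nonneg fun m => mul_nonneg (hK m) (by positivity)

/-- The Laplace transform of the kernel. -/
theorem integral_besselDensity_mul_exp_neg (hγ : 0 < γ) (hb : 0 ≤ b) (hx : 0 ≤ x) (ht : 0 < t)
    {l : ℝ} (hl : 0 ≤ l) :
    besselAtom γ b x t + ∫ y in Ioi (0 : ℝ), besselDensity γ b x y t * Real.exp (-(l * y)) =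
      (1 + l * (γ * t)) ^ (-(b / γ)) * Real.exp (-(l / (1 + l * (γ * t)) * x)) := by
  obtain ⟨K, a, hK, ha, h⟩ := exists_besselDensity_series hγ hb hx ht
  rw [setIntegral_congr_fun measurableSet_Ioi fun y hy => (h l hl).1 y hy,
    (integral_tsum_rpow_mul_exp_neg (by positivity) hK ha (h l hl).2).2, add_sub_cancel]

theorem integrableOn_besselDensity (hγ : 0 < γ) (hb : 0 ≤ b) (hx : 0 ≤ x) (ht : 0 < t) :
    IntegrableOn (fun y => besselDensity γ b x y t) (Ioi 0) := by
  obtain ⟨K, a, hK, ha, h⟩ := exists_besselDensity_series hγ hb hx ht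
  refine (integral_tsum_rpow_mul_exp_neg (by positivity) hK ha
    (h 0 le_rfl).2).1.congr_fun (fun y hy => ?_) measurableSet_Ioi
  simpa using ((h 0 le_rfl).1 y hy).symm

/-- The kernel has total mass one. -/
theorem besselAtom_add_integral_besselDensity (hγ : 0 < γ) (hb : 0 ≤ b) (hx : 0 ≤ x) (ht : 0 < t) :
    besselAtom γ b x t + ∫ y in Ioi (0 : ℝ), besselDensity γ b x y t = 1 := by
  simpa using integral_besselDensity_mul_exp_neg hγ hb hx ht le_rfl

end Laplace

/-! ### The operators on `C([0,∞])` -/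

section Operators

variable {𝕜 : Type*} [RCLike 𝕜] {γ b : ℝ}

theorem integrableOn_besselDensity_smul (hγ : 0 < γ) (hb : 0 ≤ b) {x t : ℝ} (hx : 0 ≤ x)
    (ht : 0 < t) (f : CZeroInfty 𝕜) :
    IntegrableOn (fun y => besselDensity γ b x y t • onReal f y) (Ioi 0) :=
  (integrableOn_besselDensity hγ hb hx ht).smul_bdd ‖f‖
    (continuous_onReal f).aestronglyMeasurable (ae_of_all _ (norm_onReal_le f))

theorem besselP_add (hγ : 0 < γ) (hb : 0 ≤ b) {x t : ℝ} (hx : 0 ≤ x) (ht : 0 < t)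
    (f g : CZeroInfty 𝕜) : besselP γ b t (onReal (f + g)) x =
      besselP γ b t (onReal f) x + besselP γ b t (onReal g) x := by
  simp only [besselP_eq γ b ht.ne', onReal_add, smul_add]
  rw [integral_add (integrableOn_besselDensity_smul hγ hb hx ht f)
    (integrableOn_besselDensity_smul hγ hb hx ht g)]
  abel

theorem besselP_smul {x t : ℝ} (ht : 0 < t) (c : 𝕜) (f : CZeroInfty 𝕜) :
    besselP γ b t (onReal (c • f)) x = c * besselP γ b t (onReal f) x := by
  simp only [besselP_eq γ b ht.ne', onReal_smul, ← mul_smul_comm, integral_const_mul, mul_add]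

theorem norm_besselP_le (hγ : 0 < γ) (hb : 0 ≤ b) {x t : ℝ} (hx : 0 ≤ x) (ht : 0 < t)
    (f : CZeroInfty 𝕜) : ‖besselP γ b t (onReal f) x‖ ≤ ‖f‖ := by
  rw [besselP_eq γ b ht.ne']
  have h1 : ‖besselAtom γ b x t • onReal f 0‖ ≤ besselAtom γ b x t * ‖f‖ := by
    rw [norm_smul, Real.norm_of_nonneg (besselAtom_nonneg _ _ _ _)]
    exact mul_le_mul_of_nonneg_left (norm_onReal_le f 0) (besselAtom_nonneg _ _ _ _)
  have h2 : ‖∫ y in Ioi (0 : ℝ), besselDensity γ b x y t • onReal f y‖ ≤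
      ∫ y in Ioi (0 : ℝ), besselDensity γ b x y t * ‖f‖ := by
    refine norm_integral_le_of_norm_le ((integrableOn_besselDensity hγ hb hx ht).mul_const _) ?_
    filter_upwards [ae_restrict_mem measurableSet_Ioi] with y hy
    have h0 := besselDensity_nonneg hγ hb hx ht hy
    rw [norm_smul, Real.norm_of_nonneg h0]
    exact mul_le_mul_of_nonneg_left (norm_onReal_le f y) h0
  rw [integral_mul_const] at h2
  calc _ ≤ _ := norm_add_le _ _
    _ ≤ _ := add_le_add h1 h2
    _ = ‖f‖ := by rw [← add_mul, besselAtom_add_integral_besselDensity hγ hb hx ht, one_mul]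

theorem besselP_expNeg (hγ : 0 < γ) (hb : 0 ≤ b) {x t l : ℝ} (hx : 0 ≤ x) (ht : 0 ≤ t)
    (hl : 0 ≤ l) : besselP γ b t (onReal (expNeg 𝕜 l)) x =
      onReal ((1 + l * (γ * t)) ^ (-(b / γ)) • expNeg 𝕜 (l / (1 + l * (γ * t)))) x := by
  rcases ht.eq_or_lt with rfl | ht
  · simp [besselP]
  · rw [besselP_eq γ b ht.ne', onReal_real_smul, onReal_expNeg (by positivity) hx,
      onReal_expNeg hl le_rfl, RCLike.real_smul_eq_coe_mul, RCLike.real_smul_eq_coe_mul,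
      ← RCLike.ofReal_mul, ← RCLike.ofReal_mul,
      ← integral_besselDensity_mul_exp_neg hγ hb hx ht hl, RCLike.ofReal_add,
      ← integral_ofReal]
    congr 1
    · simp
    · refine setIntegral_congr_fun measurableSet_Ioi fun y (hy : 0 < y) => ?_
      rw [onReal_expNeg hl hy.le, RCLike.real_smul_eq_coe_mul, ← RCLike.ofReal_mul]

/-- `P_t` maps `C([0,∞])` to itself: it maps exponentials to multiples of exponentials, and the
functions that are mapped into `C([0,∞])` form a closed subspace. -/
theorem exists_onReal_eq_besselP (hγ : 0 < γ) (hb : 0 ≤ b) {t : ℝ} (ht : 0 ≤ t)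
    (f : CZeroInfty 𝕜) :
    ∃ g : CZeroInfty 𝕜, ∀ x, 0 ≤ x → onReal g x = besselP γ b t (onReal f) x := by
  rcases ht.eq_or_lt with rfl | ht
  · exact ⟨f, fun x _ => by simp [besselP]⟩
  let F : Submodule 𝕜 (CZeroInfty 𝕜) :=
    { carrier := {f | ∃ g : CZeroInfty 𝕜, ∀ x, 0 ≤ x → onReal g x = besselP γ b t (onReal f) x}
      add_mem' := by
        rintro f f' ⟨g, hg⟩ ⟨g', hg'⟩
        exact ⟨g + g', fun x hx => by
          rw [besselP_add hγ hb hx ht, onReal_add, hg x hx, hg' x hx]⟩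
      zero_mem' := ⟨0, fun x hx => by
        have := norm_besselP_le hγ hb hx ht (0 : CZeroInfty 𝕜)
        rw [norm_zero, norm_le_zero_iff] at this
        rw [this, onReal_zero]⟩
      smul_mem' := by
        rintro c f ⟨g, hg⟩
        exact ⟨c • g, fun x hx => by rw [besselP_smul ht, onReal_smul, hg x hx]⟩ }
  have hsub : ∀ (f f' : CZeroInfty 𝕜) (x : ℝ), 0 ≤ x →
      ‖besselP γ b t (onReal f) x - besselP γ b t (onReal f') x‖ ≤ ‖f - f'‖ := by
    intro f f' x hx
    have h1 := besselP_add hγ hb hx ht (f - f') f'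
    rw [sub_add_cancel] at h1
    rw [h1, add_sub_cancel_right]
    exact norm_besselP_le hγ hb hx ht _
  have hexp : expSpan 𝕜 ≤ F := by
    refine Submodule.span_le.2 ?_
    rintro _ ⟨l, hl, rfl⟩
    exact ⟨_, fun x hx => (besselP_expNeg hγ hb hx ht.le hl).symm⟩
  obtain ⟨f', hf', hlim⟩ := mem_closure_iff_seq_limit.1 (dense_expSpan 𝕜 f)
  choose g hg using fun n => hexp (hf' n)
  have hc : CauchySeq g := by
    rw [Metric.cauchySeq_iff]
    intro ε hε
    obtain ⟨N, hN⟩ := Metric.cauchySeq_iff.1 hlim.cauchySeq ε hε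
    refine ⟨N, fun m hm n hn => lt_of_le_of_lt ?_ (hN m hm n hn)⟩
    rw [dist_eq_norm, dist_eq_norm]
    refine norm_le_of_onReal (norm_nonneg _) fun x hx => ?_
    rw [onReal_sub, hg m x hx, hg n x hx]
    exact hsub _ _ x hx
  obtain ⟨g₀, hg₀⟩ := cauchySeq_tendsto_of_complete hc
  refine ⟨g₀, fun x hx => ?_⟩
  refine tendsto_nhds_unique (((evalCLM 𝕜 x).continuous.tendsto g₀).comp hg₀) ?_
  rw [tendsto_iff_norm_sub_tendsto_zero] at hlim ⊢
  refine squeeze_zero (fun _ => norm_nonneg _) (fun n => ?_) hlim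
  rw [Function.comp, evalCLM_apply, hg n x hx]
  exact hsub _ _ x hx

/-- The operator `P_t` on `C([0,∞])`. -/
noncomputable def besselOp (𝕜 : Type*) [RCLike 𝕜] (hγ : 0 < γ) (hb : 0 ≤ b) (t : ℝ≥0) :
    CZeroInfty 𝕜 →L[𝕜] CZeroInfty 𝕜 :=
  have key : ∀ (f : CZeroInfty 𝕜) (x : ℝ), 0 ≤ x →
      onReal (exists_onReal_eq_besselP hγ hb t.2 f).choose x = besselP γ b t (onReal f) x :=
    fun f => (exists_onReal_eq_besselP hγ hb t.2 f).choose_spec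
  LinearMap.mkContinuous
    { toFun := fun f => (exists_onReal_eq_besselP hγ hb t.2 f).choose
      map_add' := fun f g => ext_onReal fun x hx => by
        rw [onReal_add, key _ x hx, key _ x hx, key _ x hx]
        rcases eq_or_ne t 0 with rfl | ht
        · simp [besselP]
        · exact besselP_add hγ hb hx (NNReal.coe_pos.2 (pos_iff_ne_zero.2 ht)) f g
      map_smul' := fun c f => ext_onReal fun x hx => by
        rw [RingHom.id_apply, onReal_smul, key _ x hx, key _ x hx]
        rcases eq_or_ne t 0 with rfl | ht
        · simp [besselP]
        · exact besselP_smul (NNReal.coe_pos.2 (pos_iff_ne_zero.2 ht)) c f } 1 fun f => by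
    rw [one_mul]
    refine norm_le_of_onReal (norm_nonneg _) fun x hx => ?_
    refine (congrArg norm (key f x hx)).trans_le ?_
    rcases eq_or_ne t 0 with rfl | ht
    · simpa [besselP] using norm_onReal_le f x
    · exact norm_besselP_le hγ hb hx (NNReal.coe_pos.2 (pos_iff_ne_zero.2 ht)) f

theorem onReal_besselOp (hγ : 0 < γ) (hb : 0 ≤ b) (t : ℝ≥0) (f : CZeroInfty 𝕜) {x : ℝ}
    (hx : 0 ≤ x) : onReal (besselOp 𝕜 hγ hb t f) x = besselP γ b t (onReal f) x :=
  (exists_onReal_eq_besselP hγ hb t.2 f).choose_spec x hx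

theorem norm_besselOp_apply_le (hγ : 0 < γ) (hb : 0 ≤ b) (t : ℝ≥0) (f : CZeroInfty 𝕜) :
    ‖besselOp 𝕜 hγ hb t f‖ ≤ ‖f‖ := by
  refine norm_le_of_onReal (norm_nonneg _) fun x hx => ?_
  rw [onReal_besselOp hγ hb t f hx]
  rcases eq_or_ne t 0 with rfl | ht
  · simpa [besselP] using norm_onReal_le f x
  · exact norm_besselP_le hγ hb hx (NNReal.coe_pos.2 (pos_iff_ne_zero.2 ht)) f

theorem besselOp_expNeg (hγ : 0 < γ) (hb : 0 ≤ b) (t : ℝ≥0) {l : ℝ} (hl : 0 ≤ l) :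
    besselOp 𝕜 hγ hb t (expNeg 𝕜 l) =
      (1 + l * (γ * t)) ^ (-(b / γ)) • expNeg 𝕜 (l / (1 + l * (γ * t))) :=
  ext_onReal fun x hx => by
    rw [onReal_besselOp hγ hb t _ hx]
    exact besselP_expNeg hγ hb hx t.2 hl

/-! ### The semigroup and its generator on exponentials -/

theorem besselOp_zero (hγ : 0 < γ) (hb : 0 ≤ b) :
    besselOp 𝕜 hγ hb 0 = ContinuousLinearMap.id 𝕜 (CZeroInfty 𝕜) := by
  refine ContinuousLinearMap.ext fun f => ext_onReal fun x hx => ?_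
  rw [onReal_besselOp hγ hb 0 f hx]
  simp [besselP]

theorem besselOp_add (hγ : 0 < γ) (hb : 0 ≤ b) (s t : ℝ≥0) :
    besselOp 𝕜 hγ hb (s + t) = (besselOp 𝕜 hγ hb s).comp (besselOp 𝕜 hγ hb t) := by
  refine ContinuousLinearMap.ext_on (dense_expSpan 𝕜) ?_
  rintro _ ⟨l, hl : 0 ≤ l, rfl⟩
  have h1 : 0 < 1 + l * (γ * t) := by positivity
  have hμ : 0 ≤ l / (1 + l * (γ * t)) := by positivity
  have h2 : 0 < 1 + l / (1 + l * (γ * t)) * (γ * s) := by positivity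
  have h3 : (1 + l * (γ * t)) * (1 + l / (1 + l * (γ * t)) * (γ * s)) =
      1 + l * (γ * ((s + t : ℝ≥0) : ℝ)) := by
    rw [NNReal.coe_add]; field_simp; ring
  rw [ContinuousLinearMap.comp_apply, besselOp_expNeg hγ hb _ hl, besselOp_expNeg hγ hb _ hl,
    real_smul_eq_ofReal_smul _ (expNeg 𝕜 (l / (1 + l * (γ * t)))), map_smul,
    ← real_smul_eq_ofReal_smul, besselOp_expNeg hγ hb _ hμ, smul_smul,
    ← Real.mul_rpow h1.le h2.le, div_div, h3]

/-- The curve `t ↦ P_t exp (-l ·)` is differentiable at `0` in `C([0,∞])`. -/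
theorem exists_hasDerivAt_besselOp_expNeg (𝕜 : Type*) [RCLike 𝕜] (γ b : ℝ) (hγ : 0 < γ)
    {l : ℝ} (hl : 0 ≤ l) : ∃ a : CZeroInfty 𝕜,
      (∀ x, 0 ≤ x → onReal a x = (((γ * l ^ 2 * x - b * l) * Real.exp (-(l * x)) : ℝ) : 𝕜)) ∧
      HasDerivAt (fun t : ℝ => (1 + l * (γ * t)) ^ (-(b / γ)) •
        expNeg 𝕜 (l / (1 + l * (γ * t)))) a 0 := by
  rcases hl.eq_or_lt with rfl | hl
  · refine ⟨0, fun x _ => by simp, ?_⟩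
    simpa using hasDerivAt_const (0 : ℝ) (expNeg 𝕜 0)
  obtain ⟨d, hd, hder⟩ := exists_hasDerivAt_expNeg 𝕜 hl
  have h1 : HasDerivAt (fun t : ℝ => 1 + l * (γ * t)) (l * γ) 0 := by
    simpa using (((hasDerivAt_id (0 : ℝ)).const_mul γ).const_mul l).const_add 1
  have h2 : HasDerivAt (fun t : ℝ => (1 + l * (γ * t)) ^ (-(b / γ))) (-(b * l)) 0 := by
    have := h1.rpow_const (p := -(b / γ)) (Or.inl (by simp))
    simp only [mul_zero, add_zero, Real.one_rpow] at this
    refine this.congr_deriv ?_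
    field_simp
  have h3 : HasDerivAt (fun t : ℝ => l / (1 + l * (γ * t))) (-(γ * l ^ 2)) 0 := by
    have := (hasDerivAt_const (0 : ℝ) l).fun_div h1 (by simp)
    refine this.congr_deriv ?_
    simp only [mul_zero, add_zero]; ring
  have h4 : HasDerivAt (fun t : ℝ => expNeg 𝕜 (l / (1 + l * (γ * t)))) (-(γ * l ^ 2) • d) 0 := by
    refine HasDerivAt.scomp (g₁ := expNeg 𝕜) 0 ?_ h3
    simpa using hder
  refine ⟨_, fun x hx => ?_, h2.fun_smul h4⟩
  simp only [mul_zero, add_zero, Real.one_rpow, one_smul, div_one, onReal_add, onReal_real_smul,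
    hd x hx, onReal_expNeg hl.le hx, RCLike.real_smul_eq_coe_mul, ← RCLike.ofReal_mul,
    ← RCLike.ofReal_add]
  congr 1
  ring

theorem tendsto_besselOp_apply (hγ : 0 < γ) (hb : 0 ≤ b) (u : CZeroInfty 𝕜) :
    Tendsto (fun t : ℝ≥0 => besselOp 𝕜 hγ hb t u) (𝓝[>] 0) (𝓝 u) := by
  have hspan : ∀ v ∈ expSpan 𝕜, Tendsto (fun t : ℝ≥0 => besselOp 𝕜 hγ hb t v) (𝓝[>] 0) (𝓝 v) := by
    intro v hv
    induction hv using Submodule.span_induction with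
    | mem v hv =>
      obtain ⟨l, hl : 0 ≤ l, rfl⟩ := hv
      obtain ⟨a, -, ha⟩ := exists_hasDerivAt_besselOp_expNeg 𝕜 γ b hγ hl
      have h1 := (ha.continuousAt.tendsto.comp (NNReal.continuous_coe.tendsto' 0 0 rfl)).mono_left
        (nhdsWithin_le_nhds (s := Ioi 0))
      simp only [mul_zero, add_zero, Real.one_rpow, one_smul, div_one] at h1
      exact h1.congr fun t => (besselOp_expNeg hγ hb t hl).symm
    | zero => simp
    | add v w _ _ hv hw => simpa using hv.add hw
    | smul c v _ hv => simpa using hv.const_smul c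
  rw [Metric.tendsto_nhds]
  intro ε hε
  obtain ⟨v, hv, huv⟩ := Metric.mem_closure_iff.1 (dense_expSpan 𝕜 u) (ε / 3) (by positivity)
  filter_upwards [Metric.tendsto_nhds.1 (hspan v hv) (ε / 3) (by positivity)] with t ht
  have h1 : dist (besselOp 𝕜 hγ hb t u) (besselOp 𝕜 hγ hb t v) ≤ dist u v := by
    rw [dist_eq_norm, dist_eq_norm, ← map_sub]
    exact norm_besselOp_apply_le hγ hb t _
  have h2 := dist_triangle4 (besselOp 𝕜 hγ hb t u) (besselOp 𝕜 hγ hb t v) v u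
  rw [dist_comm v u] at h2
  linarith

/-- The `C₀`-semigroup `(P_t)` on `C([0,∞])`. -/
noncomputable def besselSemigroup (𝕜 : Type*) [RCLike 𝕜] (hγ : 0 < γ) (hb : 0 ≤ b) :
    C0Semigroup 𝕜 (CZeroInfty 𝕜) where
  op := besselOp 𝕜 hγ hb
  op_zero := besselOp_zero hγ hb
  op_add := besselOp_add hγ hb
  tendsto_op := tendsto_besselOp_apply hγ hb

theorem isContraction_besselSemigroup (hγ : 0 < γ) (hb : 0 ≤ b) :
    (besselSemigroup 𝕜 hγ hb).IsContraction :=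
  norm_besselOp_apply_le hγ hb

theorem exists_hasGenerator_expNeg (hγ : 0 < γ) (hb : 0 ≤ b) {l : ℝ} (hl : 0 ≤ l) :
    ∃ a : CZeroInfty 𝕜,
      (∀ x, 0 ≤ x → onReal a x = (((γ * l ^ 2 * x - b * l) * Real.exp (-(l * x)) : ℝ) : 𝕜)) ∧
      (besselSemigroup 𝕜 hγ hb).HasGenerator (expNeg 𝕜 l) a := by
  obtain ⟨a, hax, ha⟩ := exists_hasDerivAt_besselOp_expNeg 𝕜 γ b hγ hl
  refine ⟨a, hax, ?_⟩
  have h1 : Tendsto (fun t : ℝ≥0 => (t : ℝ)) (𝓝[>] 0) (𝓝[≠] 0) := by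
    refine tendsto_nhdsWithin_iff.2
      ⟨(NNReal.continuous_coe.tendsto' 0 0 rfl).mono_left nhdsWithin_le_nhds, ?_⟩
    filter_upwards [self_mem_nhdsWithin] with t (ht : 0 < t)
    exact (NNReal.coe_pos.2 ht).ne'
  refine ((hasDerivAt_iff_tendsto_slope_zero.1 ha).comp h1).congr fun t => ?_
  rw [C0Semigroup.diffQuot_eq]
  change _ = (t : ℝ)⁻¹ • (besselOp 𝕜 hγ hb t (expNeg 𝕜 l) - expNeg 𝕜 l)
  rw [besselOp_expNeg hγ hb t hl]
  simp

theorem besselSemigroup_op_mem_expSpan (hγ : 0 < γ) (hb : 0 ≤ b) (t : ℝ≥0) :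
    ∀ u ∈ expSpan 𝕜, (besselSemigroup 𝕜 hγ hb).op t u ∈ expSpan 𝕜 := by
  intro u hu
  refine (Submodule.span_le (p := (expSpan 𝕜).comap
    ((besselSemigroup 𝕜 hγ hb).op t : CZeroInfty 𝕜 →ₗ[𝕜] CZeroInfty 𝕜))).2 ?_ hu
  rintro _ ⟨l, hl : 0 ≤ l, rfl⟩
  change besselOp 𝕜 hγ hb t (expNeg 𝕜 l) ∈ expSpan 𝕜
  rw [besselOp_expNeg hγ hb t hl, real_smul_eq_ofReal_smul]
  exact Submodule.smul_mem _ _ (expNeg_mem_expSpan (by positivity))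

end Operators

/-! ### The graph of the generator -/

section WeakSolution

variable {𝕜 : Type*} [RCLike 𝕜] {γ b : ℝ}

/-- The average `γ⁻¹ ∫₀¹ r^{b/γ-1} v(rx) dr`. For `b > 0` it is the derivative at `x` of the regular
solution of `γ x u'' + b u' = v`, that is, of `(x^{b/γ} u')' = γ⁻¹ x^{b/γ-1} v`. -/
noncomputable def besselMean (γ b : ℝ) (v : CZeroInfty 𝕜) (x : ℝ) : 𝕜 :=
  γ⁻¹ • ∫ r in (0 : ℝ)..1, r ^ (b / γ - 1) • onReal v (r * x)

theorem intervalIntegrable_rpow_smul_onReal (hγ : 0 < γ) (hb : 0 < b) (v : CZeroInfty 𝕜) (x : ℝ) :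
    IntervalIntegrable (fun r : ℝ => r ^ (b / γ - 1) • onReal v (r * x)) volume 0 1 := by
  have h0 : (-1 : ℝ) < b / γ - 1 := by linarith [div_pos hb hγ]
  have h := (intervalIntegral.intervalIntegrable_rpow' (a := 0) (b := 1) h0)
  rw [intervalIntegrable_iff] at h ⊢
  exact h.smul_bdd ‖v‖ (((continuous_onReal v).comp (by fun_prop)).aestronglyMeasurable)
    (ae_of_all _ fun r => norm_onReal_le v _)

theorem besselMean_add (hγ : 0 < γ) (hb : 0 < b) (v w : CZeroInfty 𝕜) (x : ℝ) :
    besselMean γ b (v + w) x = besselMean γ b v x + besselMean γ b w x := by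
  simp only [besselMean, onReal_add, smul_add]
  rw [intervalIntegral.integral_add (intervalIntegrable_rpow_smul_onReal hγ hb v x)
    (intervalIntegrable_rpow_smul_onReal hγ hb w x), smul_add]

theorem besselMean_smul (c : 𝕜) (v : CZeroInfty 𝕜) (x : ℝ) :
    besselMean γ b (c • v) x = c * besselMean γ b v x := by
  simp only [besselMean, onReal_smul, ← mul_smul_comm, intervalIntegral.integral_const_mul]

theorem besselMean_sub (hγ : 0 < γ) (hb : 0 < b) (v w : CZeroInfty 𝕜) (x : ℝ) :
    besselMean γ b (v - w) x = besselMean γ b v x - besselMean γ b w x := by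
  rw [eq_sub_iff_add_eq, ← besselMean_add hγ hb, sub_add_cancel]

theorem integral_rpow_div_sub_one (hγ : 0 < γ) (hb : 0 < b) :
    ∫ r in (0 : ℝ)..1, r ^ (b / γ - 1) = γ / b := by
  have h0 : 0 < b / γ := div_pos hb hγ
  rw [integral_rpow (Or.inl (by linarith)), sub_add_cancel, Real.one_rpow,
    Real.zero_rpow h0.ne', sub_zero, one_div_div]

theorem norm_besselMean_le (hγ : 0 < γ) (hb : 0 < b) (v : CZeroInfty 𝕜) (x : ℝ) :
    ‖besselMean γ b v x‖ ≤ b⁻¹ * ‖v‖ := by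
  have h0 : (-1 : ℝ) < b / γ - 1 := by linarith [div_pos hb hγ]
  have h : ‖∫ r in (0 : ℝ)..1, r ^ (b / γ - 1) • onReal v (r * x)‖ ≤
      ∫ r in (0 : ℝ)..1, r ^ (b / γ - 1) * ‖v‖ := by
    refine intervalIntegral.norm_integral_le_of_norm_le zero_le_one (ae_of_all _ fun r hr => ?_)
      ((intervalIntegral.intervalIntegrable_rpow' h0).mul_const _)
    have h1 : 0 ≤ r ^ (b / γ - 1) := Real.rpow_nonneg hr.1.le _
    rw [norm_smul, Real.norm_of_nonneg h1]
    exact mul_le_mul_of_nonneg_left (norm_onReal_le v _) h1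
  rw [intervalIntegral.integral_mul_const, integral_rpow_div_sub_one hγ hb] at h
  rw [besselMean, norm_smul, Real.norm_of_nonneg (by positivity)]
  calc γ⁻¹ * _ ≤ γ⁻¹ * (γ / b * ‖v‖) := by gcongr
    _ = b⁻¹ * ‖v‖ := by field_simp

theorem continuous_besselMean (hγ : 0 < γ) (hb : 0 < b) (v : CZeroInfty 𝕜) :
    Continuous (besselMean γ b v) := by
  have h0 : (-1 : ℝ) < b / γ - 1 := by linarith [div_pos hb hγ]
  refine (intervalIntegral.continuous_of_dominated_interval
    (bound := fun r => ‖r ^ (b / γ - 1)‖ * ‖v‖) (fun x => ?_) (fun x => ?_)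
    ((intervalIntegral.intervalIntegrable_rpow' h0).norm.mul_const _) ?_).const_smul γ⁻¹
  · exact (intervalIntegrable_iff.1 (intervalIntegrable_rpow_smul_onReal hγ hb v x)).1
  · refine ae_of_all _ fun r _ => ?_
    rw [norm_smul]
    exact mul_le_mul_of_nonneg_left (norm_onReal_le v _) (norm_nonneg _)
  · exact ae_of_all _ fun r _ => ((continuous_onReal v).comp (by fun_prop)).const_smul _

theorem besselMean_zero_right (hγ : 0 < γ) (hb : 0 < b) (v : CZeroInfty 𝕜) :
    besselMean γ b v 0 = b⁻¹ • onReal v 0 := by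
  simp only [besselMean, mul_zero]
  rw [intervalIntegral.integral_smul_const, integral_rpow_div_sub_one hγ hb, smul_smul]
  congr 1
  field_simp

/-- The right-hand side in the equation
`u'(x) = (γx)⁻¹ (∫₀ˣ v + (γ - b) (u(x) - u(0)))`, which is `(γ x u' - (γ - b) u)' = v`
integrated from `0`. -/
noncomputable def besselFlux (γ b : ℝ) (u v : CZeroInfty 𝕜) (x : ℝ) : 𝕜 :=
  (γ * x)⁻¹ • ((∫ s in (0 : ℝ)..x, onReal v s) + (γ - b) • (onReal u x - onReal u 0))

theorem intervalIntegrable_onReal (v : CZeroInfty 𝕜) (x y : ℝ) :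
    IntervalIntegrable (onReal v) volume x y :=
  (continuous_onReal v).intervalIntegrable x y

theorem besselFlux_add (u v u' v' : CZeroInfty 𝕜) (x : ℝ) :
    besselFlux γ b (u + u') (v + v') x = besselFlux γ b u v x + besselFlux γ b u' v' x := by
  simp only [besselFlux, onReal_add]
  rw [intervalIntegral.integral_add (intervalIntegrable_onReal v _ _)
    (intervalIntegrable_onReal v' _ _), ← smul_add]
  congr 1
  simp only [smul_sub, smul_add]
  abel

theorem besselFlux_smul (c : 𝕜) (u v : CZeroInfty 𝕜) (x : ℝ) :
    besselFlux γ b (c • u) (c • v) x = c * besselFlux γ b u v x := by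
  simp only [besselFlux, onReal_smul]
  rw [intervalIntegral.integral_const_mul, ← mul_sub, ← mul_smul_comm, ← mul_add, mul_smul_comm]

theorem besselFlux_sub (u v u' v' : CZeroInfty 𝕜) (x : ℝ) :
    besselFlux γ b (u - u') (v - v') x = besselFlux γ b u v x - besselFlux γ b u' v' x := by
  rw [eq_sub_iff_add_eq, ← besselFlux_add, sub_add_cancel, sub_add_cancel]

theorem norm_besselFlux_le (hγ : 0 < γ) (u v : CZeroInfty 𝕜) {x₀ x : ℝ} (hx₀ : 0 < x₀)
    (hx : x₀ ≤ x) : ‖besselFlux γ b u v x‖ ≤ γ⁻¹ * ‖v‖ + (γ * x₀)⁻¹ * (|γ - b| * (2 * ‖u‖)) := by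
  have hx' : 0 < x := hx₀.trans_le hx
  have h1 : ‖∫ s in (0 : ℝ)..x, onReal v s‖ ≤ ‖v‖ * x := by
    have := intervalIntegral.norm_integral_le_of_norm_le_const (a := 0) (b := x)
      (f := onReal v) fun s _ => norm_onReal_le v s
    rwa [sub_zero, abs_of_pos hx'] at this
  have h2 : ‖(γ - b) • (onReal u x - onReal u 0)‖ ≤ |γ - b| * (2 * ‖u‖) := by
    rw [norm_smul, Real.norm_eq_abs]
    gcongr
    linarith [norm_sub_le (onReal u x) (onReal u 0), norm_onReal_le u x, norm_onReal_le u 0]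
  rw [besselFlux, norm_smul, Real.norm_of_nonneg (by positivity)]
  calc (γ * x)⁻¹ * _ ≤ (γ * x)⁻¹ * (‖v‖ * x + |γ - b| * (2 * ‖u‖)) := by
        gcongr
        exact (norm_add_le _ _).trans (add_le_add h1 h2)
    _ = γ⁻¹ * ‖v‖ + (γ * x)⁻¹ * (|γ - b| * (2 * ‖u‖)) := by field_simp
    _ ≤ _ := by gcongr

/-- The graph of `A^{γ,b}`, described by conditions that are linear and pass to uniform limits:
once integrated forms of `γ x u'' + b u' = v`, and boundary conditions on `v`. The first integrated
form gives the interior regularity for all `b`. The second one is needed for `b > 0`, to rule out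
the singular solutions of `γ x u'' + b u' = 0` at `0`. -/
structure IsWeakSolution (γ b : ℝ) (u v : CZeroInfty 𝕜) : Prop where
  hasDerivAt_flux : ∀ x, 0 < x → HasDerivAt (onReal u) (besselFlux γ b u v x) x
  hasDerivAt_mean : 0 < b → ∀ x, 0 < x → HasDerivAt (onReal u) (besselMean γ b v x) x
  tendsto_zero : Tendsto (onReal v) atTop (𝓝 0)
  apply_zero : b = 0 → onReal v 0 = 0

theorem IsWeakSolution.add (hγ : 0 < γ) {u v u' v' : CZeroInfty 𝕜} (h : IsWeakSolution γ b u v)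
    (h' : IsWeakSolution γ b u' v') : IsWeakSolution γ b (u + u') (v + v') where
  hasDerivAt_flux x hx := by
    rw [besselFlux_add]
    exact (h.hasDerivAt_flux x hx).add (h'.hasDerivAt_flux x hx)
  hasDerivAt_mean hb x hx := by
    rw [besselMean_add hγ hb]
    exact (h.hasDerivAt_mean hb x hx).add (h'.hasDerivAt_mean hb x hx)
  tendsto_zero := by
    have := h.tendsto_zero.add h'.tendsto_zero
    rwa [add_zero] at this
  apply_zero hb := by rw [onReal_add, h.apply_zero hb, h'.apply_zero hb, add_zero]

theorem IsWeakSolution.smul (c : 𝕜) {u v : CZeroInfty 𝕜} (h : IsWeakSolution γ b u v) :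
    IsWeakSolution γ b (c • u) (c • v) where
  hasDerivAt_flux x hx := by
    rw [besselFlux_smul]
    exact (h.hasDerivAt_flux x hx).const_mul c
  hasDerivAt_mean hb x hx := by
    rw [besselMean_smul]
    exact (h.hasDerivAt_mean hb x hx).const_mul c
  tendsto_zero := by
    have := h.tendsto_zero.const_mul c
    rwa [mul_zero] at this
  apply_zero hb := by rw [onReal_smul, h.apply_zero hb, mul_zero]

theorem tendstoUniformlyOn_of_norm_sub_le {f : ℕ → ℝ → 𝕜} {g : ℝ → 𝕜} {s : Set ℝ} {B : ℕ → ℝ}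
    (hB : Tendsto B atTop (𝓝 0)) (h : ∀ n, ∀ x ∈ s, ‖f n x - g x‖ ≤ B n) :
    TendstoUniformlyOn f g atTop s := by
  rw [Metric.tendstoUniformlyOn_iff]
  intro ε hε
  filter_upwards [hB.eventually_lt_const hε] with n hn x hx
  rw [dist_comm, dist_eq_norm]
  exact (h n x hx).trans_lt hn

theorem IsWeakSolution.of_tendsto (hγ : 0 < γ) {u v : ℕ → CZeroInfty 𝕜} {u₀ v₀ : CZeroInfty 𝕜}
    (h : ∀ n, IsWeakSolution γ b (u n) (v n)) (hu : Tendsto u atTop (𝓝 u₀))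
    (hv : Tendsto v atTop (𝓝 v₀)) : IsWeakSolution γ b u₀ v₀ := by
  have hux : ∀ x, Tendsto (fun n => onReal (u n) x) atTop (𝓝 (onReal u₀ x)) := fun x =>
    ((evalCLM 𝕜 x).continuous.tendsto u₀).comp hu
  have hvx : ∀ x, Tendsto (fun n => onReal (v n) x) atTop (𝓝 (onReal v₀ x)) := fun x =>
    ((evalCLM 𝕜 x).continuous.tendsto v₀).comp hv
  have hu' := tendsto_iff_norm_sub_tendsto_zero.1 hu
  have hv' := tendsto_iff_norm_sub_tendsto_zero.1 hv
  refine ⟨fun x hx => ?_, fun hb x hx => ?_, ?_, fun hb => ?_⟩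
  · refine hasDerivAt_of_tendstoUniformlyOn (s := Ioi (x / 2))
      (f' := fun n => besselFlux γ b (u n) (v n)) isOpen_Ioi
      (tendstoUniformlyOn_of_norm_sub_le (B := fun n => γ⁻¹ * ‖v n - v₀‖ +
        (γ * (x / 2))⁻¹ * (|γ - b| * (2 * ‖u n - u₀‖))) ?_ fun n y hy => ?_)
      (Eventually.of_forall fun n y (hy : x / 2 < y) => (h n).hasDerivAt_flux y (by linarith))
      (fun y _ => hux y) (by simpa using hx)
    · simpa using (hv'.const_mul γ⁻¹).add
        (((hu'.const_mul 2).const_mul |γ - b|).const_mul (γ * (x / 2))⁻¹)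
    · rw [← besselFlux_sub]
      exact norm_besselFlux_le hγ _ _ (half_pos hx) (le_of_lt hy)
  · refine hasDerivAt_of_tendstoUniformlyOn (s := Ioi 0) (f' := fun n => besselMean γ b (v n))
      isOpen_Ioi (tendstoUniformlyOn_of_norm_sub_le (B := fun n => b⁻¹ * ‖v n - v₀‖) ?_
        fun n y _ => ?_) (Eventually.of_forall fun n y hy => (h n).hasDerivAt_mean hb y hy)
      (fun y _ => hux y) hx
    · simpa using hv'.const_mul b⁻¹
    · rw [← besselMean_sub hγ hb]
      exact norm_besselMean_le hγ hb _ _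
  · rw [Metric.tendsto_nhds]
    intro ε hε
    obtain ⟨n, hn⟩ := (hv'.eventually_lt_const (half_pos hε)).exists
    filter_upwards [Metric.tendsto_nhds.1 (h n).tendsto_zero (ε / 2) (half_pos hε)] with x hx
    have h1 := norm_onReal_le (v n - v₀) x
    rw [onReal_sub, norm_sub_rev] at h1
    rw [dist_zero_right] at hx ⊢
    have h2 := norm_add_le (onReal v₀ x - onReal (v n) x) (onReal (v n) x)
    rw [sub_add_cancel] at h2
    linarith
  · exact tendsto_nhds_unique (hvx 0) (by simp [(h _).apply_zero hb])

theorem hasDerivAt_onReal_expNeg {l x : ℝ} (hl : 0 ≤ l) (hx : 0 < x) :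
    HasDerivAt (onReal (expNeg 𝕜 l)) ((-(l * Real.exp (-(l * x))) : ℝ) : 𝕜) x := by
  have h1 : HasDerivAt (fun y : ℝ => Real.exp (-(l * y))) (-(l * Real.exp (-(l * x)))) x := by
    refine (((hasDerivAt_id x).const_mul l).neg.exp).congr_deriv ?_
    simp; ring
  refine ((RCLike.ofRealCLM (K := 𝕜)).hasFDerivAt.comp_hasDerivAt x h1).congr_of_eventuallyEq ?_
  filter_upwards [lt_mem_nhds hx] with y hy using onReal_expNeg hl hy.le

theorem isWeakSolution_expNeg (hγ : 0 < γ) {l : ℝ} (hl : 0 ≤ l) {a : CZeroInfty 𝕜}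
    (ha : ∀ x, 0 ≤ x →
      onReal a x = (((γ * l ^ 2 * x - b * l) * Real.exp (-(l * x)) : ℝ) : 𝕜)) :
    IsWeakSolution γ b (expNeg 𝕜 l) a := by
  refine ⟨fun x hx => ?_, fun hb x hx => ?_, ?_, fun hb => ?_⟩
  · refine (hasDerivAt_onReal_expNeg hl hx).congr_deriv ?_
    have hint : ∫ s in (0 : ℝ)..x, onReal a s = ((-(γ * l * x * Real.exp (-(l * x))) -
        (γ - b) * (Real.exp (-(l * x)) - 1) : ℝ) : 𝕜) := by
      have h1 : ∫ s in (0 : ℝ)..x, (γ * l ^ 2 * s - b * l) * Real.exp (-(l * s)) =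
          -(γ * l * x * Real.exp (-(l * x))) - (γ - b) * (Real.exp (-(l * x)) - 1) := by
        rw [intervalIntegral.integral_eq_sub_of_hasDerivAt (f := fun s : ℝ =>
          (-(γ * l * s) - (γ - b)) * Real.exp (-(l * s))) (fun s _ => ?_)
          (Continuous.intervalIntegrable (by fun_prop) _ _)]
        · simp; ring
        · have e1 : HasDerivAt (fun s : ℝ => Real.exp (-(l * s)))
              (-(l * Real.exp (-(l * s)))) s := by
            refine (((hasDerivAt_id s).const_mul l).neg.exp).congr_deriv ?_
            simp; ring
          have e2 : HasDerivAt (fun s : ℝ => -(γ * l * s) - (γ - b)) (-(γ * l)) s := by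
            simpa using (((hasDerivAt_id s).const_mul (γ * l)).fun_neg).sub_const (γ - b)
          refine (e2.fun_mul e1).congr_deriv ?_
          ring
      rw [← h1, ← RCLike.intervalIntegral_ofReal]
      refine intervalIntegral.integral_congr fun s hs => ?_
      rw [uIcc_of_le hx.le] at hs
      exact ha s hs.1
    rw [besselFlux, hint, onReal_expNeg hl hx.le, onReal_expNeg hl le_rfl,
      RCLike.real_smul_eq_coe_mul, RCLike.real_smul_eq_coe_mul, ← RCLike.ofReal_sub,
      ← RCLike.ofReal_mul, ← RCLike.ofReal_add, ← RCLike.ofReal_mul]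
    congr 1
    simp only [mul_zero, neg_zero, Real.exp_zero]
    field_simp
    ring
  · refine (hasDerivAt_onReal_expNeg hl hx).congr_deriv ?_
    have hν : 0 < b / γ := div_pos hb hγ
    have h1 : ∫ r in (0 : ℝ)..1, r ^ (b / γ - 1) *
        ((γ * l ^ 2 * (r * x) - b * l) * Real.exp (-(l * (r * x)))) =
        -(γ * l * Real.exp (-(l * x))) := by
      have hcont : Continuous fun r : ℝ =>
          -(γ * l) * (r ^ (b / γ) * Real.exp (-(l * (r * x)))) := by
        have : Continuous fun r : ℝ => r ^ (b / γ) := Real.continuous_rpow_const hν.le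
        fun_prop
      have hder : ∀ r ∈ Ioo (0 : ℝ) 1, HasDerivAt
          (fun r : ℝ => -(γ * l) * (r ^ (b / γ) * Real.exp (-(l * (r * x)))))
          (r ^ (b / γ - 1) * ((γ * l ^ 2 * (r * x) - b * l) * Real.exp (-(l * (r * x))))) r := by
        intro r hr
        have e1 : HasDerivAt (fun r : ℝ => Real.exp (-(l * (r * x))))
            (-(l * x * Real.exp (-(l * (r * x))))) r := by
          refine ((((hasDerivAt_id r).mul_const x).const_mul l).neg.exp).congr_deriv ?_
          simp; ring
        have e2 := Real.hasDerivAt_rpow_const (x := r) (p := b / γ) (Or.inl hr.1.ne')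
        refine ((e2.fun_mul e1).const_mul (-(γ * l))).congr_deriv ?_
        have e3 : r ^ (b / γ) = r ^ (b / γ - 1) * r := by
          rw [← Real.rpow_add_one hr.1.ne', sub_add_cancel]
        rw [e3]
        field_simp
        ring
      have hint : IntervalIntegrable (fun r : ℝ => r ^ (b / γ - 1) *
          ((γ * l ^ 2 * (r * x) - b * l) * Real.exp (-(l * (r * x))))) volume 0 1 :=
        (intervalIntegral.intervalIntegrable_rpow' (by linarith)).mul_continuousOn
          (Continuous.continuousOn (by fun_prop))
      rw [intervalIntegral.integral_eq_sub_of_hasDerivAt_of_le zero_le_one hcont.continuousOn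
        hder hint]
      simp [Real.zero_rpow hν.ne']
    rw [besselMean, RCLike.real_smul_eq_coe_mul]
    have h2 : ∫ r in (0 : ℝ)..1, r ^ (b / γ - 1) • onReal a (r * x) =
        ((-(γ * l * Real.exp (-(l * x))) : ℝ) : 𝕜) := by
      rw [← h1, ← RCLike.intervalIntegral_ofReal]
      refine intervalIntegral.integral_congr fun r hr => ?_
      rw [uIcc_of_le zero_le_one] at hr
      rw [ha _ (mul_nonneg hr.1 hx.le), RCLike.real_smul_eq_coe_mul, ← RCLike.ofReal_mul]
    rw [h2, ← RCLike.ofReal_mul]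
    congr 1
    field_simp
  · have h1 : Tendsto (fun x : ℝ => (((γ * l ^ 2 * x - b * l) * Real.exp (-(l * x)) : ℝ) : 𝕜))
        atTop (𝓝 0) := by
      rcases hl.eq_or_lt with rfl | hl
      · simp
      · have := (RCLike.continuous_ofReal (K := 𝕜)).tendsto 0 |>.comp
          (tendsto_mul_exp_neg_atTop hl (γ * l ^ 2) (-(b * l)))
        simpa [Function.comp_def, sub_eq_add_neg] using this
    refine h1.congr' ?_
    filter_upwards [eventually_ge_atTop 0] with x hx using (ha x hx).symm
  · simp [ha 0 le_rfl, hb]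

/-- The generator of the semigroup is contained in `A^{γ,b}`. -/
theorem isWeakSolution_of_hasGenerator (hγ : 0 < γ) (hb : 0 ≤ b) {u v : CZeroInfty 𝕜}
    (h : (besselSemigroup 𝕜 hγ hb).HasGenerator u v) : IsWeakSolution γ b u v := by
  have hspan : ∀ u ∈ expSpan 𝕜, ∃ v, (besselSemigroup 𝕜 hγ hb).HasGenerator u v ∧
      IsWeakSolution γ b u v := by
    intro u hu
    induction hu using Submodule.span_induction with
    | mem u hu =>
      obtain ⟨l, hl : 0 ≤ l, rfl⟩ := hu
      obtain ⟨a, hax, ha⟩ := exists_hasGenerator_expNeg (𝕜 := 𝕜) hγ hb hl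
      exact ⟨a, ha, isWeakSolution_expNeg hγ hl hax⟩
    | zero =>
      obtain ⟨a, hax, ha⟩ := exists_hasGenerator_expNeg (𝕜 := 𝕜) hγ hb le_rfl
      have h1 := ha.smul (0 : 𝕜)
      have h2 := (isWeakSolution_expNeg hγ le_rfl hax).smul (0 : 𝕜)
      rw [zero_smul] at h1 h2
      exact ⟨_, h1, h2⟩
    | add u u' _ _ hu hu' =>
      obtain ⟨v, hv, hw⟩ := hu
      obtain ⟨v', hv', hw'⟩ := hu'
      exact ⟨v + v', hv.add hv', hw.add hγ hw'⟩
    | smul c u _ hu =>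
      obtain ⟨v, hv, hw⟩ := hu
      exact ⟨c • v, hv.smul c, hw.smul c⟩
  obtain ⟨u', v', hu', hv', hlu, hlv⟩ := h.exists_core_seq
    (isContraction_besselSemigroup hγ hb) (dense_expSpan 𝕜)
    (fun u hu => (hspan u hu).imp fun _ h => h.1) (besselSemigroup_op_mem_expSpan hγ hb)
  refine IsWeakSolution.of_tendsto hγ (fun n => ?_) hlu hlv
  obtain ⟨w, hw, hw'⟩ := hspan (u' n) (hu' n)
  rwa [(hv' n).unique hw]

end WeakSolution

/-! ### The domain of `A^{γ,b}` -/

section Domain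

variable {𝕜 : Type*} [RCLike 𝕜] {γ b : ℝ}

theorem hasDerivAt_besselFlux (hγ : 0 < γ) {u v : CZeroInfty 𝕜} (h : IsWeakSolution γ b u v)
    {x : ℝ} (hx : 0 < x) : HasDerivAt (besselFlux γ b u v)
      ((γ * x)⁻¹ • (onReal v x - b • besselFlux γ b u v x)) x := by
  have h1 : HasDerivAt (fun x : ℝ => ∫ s in (0 : ℝ)..x, onReal v s) (onReal v x) x :=
    (continuous_onReal v).integral_hasStrictDerivAt 0 x |>.hasDerivAt
  have h2 := h1.fun_add (((h.hasDerivAt_flux x hx).sub_const (onReal u 0)).const_smul (γ - b))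
  have h3 : HasDerivAt (fun x : ℝ => (γ * x)⁻¹) (-γ / (γ * x) ^ 2) x := by
    simpa using ((hasDerivAt_id x).const_mul γ).fun_inv (by positivity)
  refine (h3.fun_smul h2).congr_deriv ?_
  -- The integral and the difference quotient of `u` are recombined into the flux itself.
  have h4 : (∫ s in (0 : ℝ)..x, onReal v s) + (γ - b) • (onReal u x - onReal u 0) =
      (γ * x) • besselFlux γ b u v x := by
    rw [besselFlux, smul_smul, mul_inv_cancel₀ (by positivity), one_smul]
  have h5 : -γ / (γ * x) ^ 2 * (γ * x) = -((γ * x)⁻¹ * γ) := by field_simp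
  dsimp only [Pi.smul_apply]
  rw [h4, smul_smul, h5, ← sub_eq_zero]
  module

theorem contDiffOn_two_of_hasDerivAt {E : Type*} [NormedAddCommGroup E] [NormedSpace ℝ E]
    {f f' f'' : ℝ → E} {s : Set ℝ} (hs : IsOpen s) (h : ∀ x ∈ s, HasDerivAt f (f' x) x)
    (h' : ∀ x ∈ s, HasDerivAt f' (f'' x) x) (hc : ContinuousOn f'' s) : ContDiffOn ℝ 2 f s := by
  have hd : ∀ x ∈ s, deriv f x = f' x := fun x hx => (h x hx).deriv
  have hd' : ∀ x ∈ s, deriv f' x = f'' x := fun x hx => (h' x hx).deriv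
  rw [show (2 : WithTop ℕ∞) = 1 + 1 by norm_num, contDiffOn_succ_iff_deriv_of_isOpen hs]
  refine ⟨fun x hx => (h x hx).differentiableAt.differentiableWithinAt, by simp, ?_⟩
  refine ContDiffOn.congr ?_ hd
  rw [show (1 : WithTop ℕ∞) = 0 + 1 by norm_num, contDiffOn_succ_iff_deriv_of_isOpen hs]
  refine ⟨fun x hx => (h' x hx).differentiableAt.differentiableWithinAt, by simp, ?_⟩
  exact contDiffOn_zero.2 (hc.congr hd')

theorem IsWeakSolution.deriv_eq {u v : CZeroInfty 𝕜} (h : IsWeakSolution γ b u v) {x : ℝ}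
    (hx : 0 < x) : deriv (onReal u) x = besselFlux γ b u v x :=
  (h.hasDerivAt_flux x hx).deriv

theorem IsWeakSolution.hasDerivAt_deriv (hγ : 0 < γ) {u v : CZeroInfty 𝕜}
    (h : IsWeakSolution γ b u v) {x : ℝ} (hx : 0 < x) : HasDerivAt (deriv (onReal u))
      ((γ * x)⁻¹ • (onReal v x - b • besselFlux γ b u v x)) x := by
  refine (hasDerivAt_besselFlux hγ h hx).congr_of_eventuallyEq ?_
  filter_upwards [lt_mem_nhds hx] with y hy using h.deriv_eq hy

theorem IsWeakSolution.besselA_eq (hγ : 0 < γ) {u v : CZeroInfty 𝕜} (h : IsWeakSolution γ b u v)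
    {x : ℝ} (hx : 0 < x) : besselA γ b (onReal u) x = onReal v x := by
  rw [besselA, (h.hasDerivAt_deriv hγ hx).deriv, h.deriv_eq hx, smul_smul,
    mul_inv_cancel₀ (by positivity), one_smul, sub_add_cancel]

theorem IsWeakSolution.mem_besselDomain (hγ : 0 < γ) {u v : CZeroInfty 𝕜}
    (h : IsWeakSolution γ b u v) : u ∈ besselDomain 𝕜 γ b := by
  have hv0 : Tendsto (onReal v) (𝓝[>] 0) (𝓝 (onReal v 0)) :=
    ((continuous_onReal v).tendsto 0).mono_left nhdsWithin_le_nhds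
  have hA : ∀ x ∈ Ioi (0 : ℝ), besselA γ b (onReal u) x = onReal v x := fun x hx =>
    h.besselA_eq hγ hx
  refine ⟨?_, fun hb => ?_, fun hb => ⟨?_, ?_⟩, ?_⟩
  · refine contDiffOn_two_of_hasDerivAt isOpen_Ioi (fun x hx => h.hasDerivAt_flux x hx)
      (fun x hx => hasDerivAt_besselFlux hγ h hx) ?_
    refine ContinuousOn.smul (ContinuousOn.inv₀ (by fun_prop)
      fun x hx => (mul_pos hγ hx).ne') ?_
    refine (continuous_onReal v).continuousOn.sub (ContinuousOn.const_smul ?_ b)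
    exact fun x hx => (hasDerivAt_besselFlux hγ h hx).continuousAt.continuousWithinAt
  · rw [h.apply_zero hb] at hv0
    refine hv0.congr' ?_
    filter_upwards [self_mem_nhdsWithin] with x hx using (hA x hx).symm
  · have hmean := h.hasDerivAt_mean hb
    have hc := continuous_besselMean hγ hb v
    have h0 : HasDerivWithinAt (onReal u) (besselMean γ b v 0) (Ici 0) 0 := by
      refine hasDerivWithinAt_Ici_of_tendsto_deriv (s := Ioi 0)
        (fun x hx => (hmean x hx).differentiableAt.differentiableWithinAt)
        (continuous_onReal u).continuousWithinAt self_mem_nhdsWithin ?_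
      refine ((hc.tendsto 0).mono_left nhdsWithin_le_nhds).congr' ?_
      filter_upwards [self_mem_nhdsWithin] with x hx using (hmean x hx).deriv.symm
    have hall : ∀ x ∈ Ici (0 : ℝ), HasDerivWithinAt (onReal u) (besselMean γ b v x) (Ici 0) x := by
      intro x hx
      rcases (mem_Ici.1 hx).eq_or_lt with rfl | hx
      · exact h0
      · exact (hmean x hx).hasDerivWithinAt
    rw [show (1 : WithTop ℕ∞) = 0 + 1 by norm_num,
      contDiffOn_succ_iff_derivWithin (uniqueDiffOn_Ici 0)]
    refine ⟨fun x hx => (hall x hx).differentiableWithinAt, by simp, contDiffOn_zero.2 ?_⟩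
    exact hc.continuousOn.congr fun x hx =>
      (hall x hx).derivWithin (uniqueDiffOn_Ici 0 x hx)
  · have hm : Tendsto (besselMean γ b v) (𝓝[>] 0) (𝓝 (b⁻¹ • onReal v 0)) := by
      rw [← besselMean_zero_right hγ hb]
      exact ((continuous_besselMean hγ hb v).tendsto 0).mono_left nhdsWithin_le_nhds
    have hl := (hv0.sub (hm.const_smul b)).const_smul γ⁻¹
    rw [smul_smul, mul_inv_cancel₀ hb.ne', one_smul, sub_self, smul_zero] at hl
    refine hl.congr' ?_
    filter_upwards [self_mem_nhdsWithin] with x (hx : 0 < x)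
    rw [(h.hasDerivAt_deriv hγ hx).deriv, ← h.deriv_eq hx, (h.hasDerivAt_mean hb x hx).deriv,
      smul_smul]
    congr 1
    field_simp
  · refine h.tendsto_zero.congr' ?_
    filter_upwards [eventually_gt_atTop 0] with x hx using (hA x hx).symm

/-- `A^{γ,b} u` extends continuously to `[0,∞]` for `u` in the domain. -/
theorem exists_onReal_eq_besselA (hb : 0 ≤ b) {u : CZeroInfty 𝕜}
    (hu : u ∈ besselDomain 𝕜 γ b) : ∃ a : CZeroInfty 𝕜,
      (∀ x, 0 < x → onReal a x = besselA γ b (onReal u) x) ∧ (b = 0 → onReal a 0 = 0) := by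
  obtain ⟨h2, hz, hp, hinf⟩ := hu
  obtain ⟨l, hl, hl0⟩ : ∃ l, Tendsto (besselA γ b (onReal u)) (𝓝[>] 0) (𝓝 l) ∧ (b = 0 → l = 0) := by
    rcases hb.eq_or_lt with hb | hb
    · exact ⟨0, hz hb.symm, fun _ => rfl⟩
    · obtain ⟨h1, hxu⟩ := hp hb
      have hd : Tendsto (deriv (onReal u)) (𝓝[>] 0) (𝓝 (derivWithin (onReal u) (Ici 0) 0)) := by
        have := (h1.continuousOn_derivWithin (uniqueDiffOn_Ici 0) le_rfl 0 self_mem_Ici).mono_left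
          (nhdsWithin_mono 0 Ioi_subset_Ici_self)
        refine this.congr' ?_
        filter_upwards [self_mem_nhdsWithin] with x (hx : 0 < x)
        exact derivWithin_of_mem_nhds (Ici_mem_nhds hx)
      refine ⟨_, ((hxu.const_smul γ).add (hd.const_smul b)).congr fun x => ?_,
        fun h => absurd h hb.ne'⟩
      rw [smul_smul]
      rfl
  have hcd : ContinuousOn (besselA γ b (onReal u)) (Ioi 0) := by
    have hd1 : ContDiffOn ℝ 1 (deriv (onReal u)) (Ioi 0) := by
      rw [show (2 : WithTop ℕ∞) = 1 + 1 by norm_num,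
        contDiffOn_succ_iff_deriv_of_isOpen isOpen_Ioi] at h2
      exact h2.2.2
    have hd2 := hd1.continuousOn_deriv_of_isOpen isOpen_Ioi le_rfl
    exact (ContinuousOn.smul (by fun_prop) hd2).add (hd1.continuousOn.const_smul b)
  have hc : ContinuousOn (Function.update (besselA γ b (onReal u)) 0 l) (Ici 0) := by
    intro x hx
    rcases (mem_Ici.1 hx).eq_or_lt with rfl | hx
    · rw [continuousWithinAt_update_same, Ici_sdiff_left]
      exact hl
    · refine ContinuousAt.continuousWithinAt ?_
      rw [continuousAt_update_of_ne hx.ne']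
      exact hcd.continuousAt (Ioi_mem_nhds hx)
  obtain ⟨a, ha⟩ := exists_onReal_eq hc (l := 0) (hinf.congr' (by
    filter_upwards [eventually_gt_atTop 0] with x hx
    rw [Function.update_of_ne hx.ne']))
  refine ⟨a, fun x hx => ?_, fun h => ?_⟩
  · rw [ha x hx.le, Function.update_of_ne hx.ne']
  · rw [ha 0 le_rfl, Function.update_self, hl0 h]

/-- Maximum principle: a function with `γ x g'' + b g' = g` that vanishes at infinity and satisfies
the boundary condition at `0` has no positive maximum. At an interior maximum one would have
`g' = 0` and `g'' > 0`; if `b > 0`, at the boundary point `0` one would have `g'(0+) > 0`. -/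
theorem nonpos_of_besselA_eq_self (hγ : 0 < γ) (hb : 0 ≤ b) {g g' g'' : ℝ → ℝ} (hc : Continuous g)
    (hinf : Tendsto g atTop (𝓝 0)) (h1 : ∀ x, 0 < x → HasDerivAt g (g' x) x)
    (h2 : ∀ x, 0 < x → HasDerivAt g' (g'' x) x)
    (heq : ∀ x, 0 < x → γ * x * g'' x + b * g' x = g x) (hb0 : b = 0 → g 0 = 0)
    (hbpos : 0 < b → Tendsto (fun x => x * g'' x) (𝓝[>] 0) (𝓝 0)) {x : ℝ} (hx : 0 ≤ x) :
    g x ≤ 0 := by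
  by_contra! hpos
  obtain ⟨N, hN⟩ := eventually_atTop.1 (hinf.eventually_lt_const hpos)
  have hxN : x < N := by
    by_contra! h
    exact lt_irrefl _ (hN x h)
  obtain ⟨m, hm, hmax⟩ := (isCompact_Icc (a := (0 : ℝ)) (b := N)).exists_isMaxOn
    ⟨x, hx, hxN.le⟩ hc.continuousOn
  have hgm : 0 < g m := hpos.trans_le (hmax ⟨hx, hxN.le⟩)
  have hmax' : ∀ y, 0 ≤ y → g y ≤ g m := by
    intro y hy
    rcases le_total y N with h | h
    · exact hmax ⟨hy, h⟩
    · exact (hN y h).le.trans (hmax ⟨hx, hxN.le⟩)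
  rcases hm.1.eq_or_lt with rfl | hm0
  · rcases hb.eq_or_lt with rfl | hb
    · exact hgm.ne' (hb0 rfl)
    · have hlim : Tendsto (fun x => g x - γ * (x * g'' x)) (𝓝[>] 0) (𝓝 (g 0)) := by
        have := ((hc.tendsto 0).mono_left nhdsWithin_le_nhds).sub ((hbpos hb).const_mul γ)
        simpa using this
      obtain ⟨ε, hε, hpos'⟩ := mem_nhdsGT_iff_exists_Ioo_subset.1
        (hlim.eventually_const_lt hgm)
      have hmono : StrictMonoOn g (Icc 0 ε) := by
        refine strictMonoOn_of_deriv_pos (convex_Icc 0 ε) hc.continuousOn fun y hy => ?_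
        rw [interior_Icc] at hy
        rw [(h1 y hy.1).deriv]
        have h3 : 0 < g y - γ * (y * g'' y) := hpos' hy
        have h4 : b * g' y = g y - γ * (y * g'' y) := by rw [← heq y hy.1]; ring
        exact pos_of_mul_pos_right (h4 ▸ h3) hb.le
      have hε' : (0 : ℝ) < ε := hε
      exact absurd (hmono ⟨le_rfl, hε'.le⟩ ⟨hε'.le, le_rfl⟩ hε') (not_lt.2 (hmax' ε hε'.le))
  · have hlmax : IsLocalMax g m := by
      filter_upwards [lt_mem_nhds hm0] with y hy using hmax' y hy.le
    have hg' : g' m = 0 := hlmax.hasDerivAt_eq_zero (h1 m hm0)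
    have hg'' : 0 < g'' m := by
      have := heq m hm0
      rw [hg', mul_zero, add_zero] at this
      exact pos_of_mul_pos_right (this ▸ hgm) (mul_pos hγ hm0).le
    have hderiv : deriv g =ᶠ[𝓝 m] g' := by
      filter_upwards [lt_mem_nhds hm0] with y hy using (h1 y hy).deriv
    have hdd : deriv (deriv g) m = g'' m := by rw [hderiv.deriv_eq, (h2 m hm0).deriv]
    have hlmin : IsLocalMin g m := isLocalMin_of_deriv_deriv_pos (by rwa [hdd])
      (by rw [(h1 m hm0).deriv, hg']) hc.continuousAt
    have hconst : g =ᶠ[𝓝 m] fun _ => g m := by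
      filter_upwards [hlmax, hlmin] with y h3 h4 using le_antisymm h3 h4
    have := hconst.deriv.deriv_eq
    rw [hdd] at this
    simp at this
    exact hg''.ne' this

theorem hasDerivAt_deriv_of_contDiffOn_two {f : ℝ → 𝕜} (h : ContDiffOn ℝ 2 f (Ioi 0)) {x : ℝ}
    (hx : 0 < x) : HasDerivAt f (deriv f x) x ∧ HasDerivAt (deriv f) (deriv (deriv f) x) x := by
  rw [show (2 : WithTop ℕ∞) = 1 + 1 by norm_num,
    contDiffOn_succ_iff_deriv_of_isOpen isOpen_Ioi] at h
  exact ⟨(h.1.differentiableAt (Ioi_mem_nhds hx)).hasDerivAt,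
    ((h.2.2.differentiableOn one_ne_zero).differentiableAt (Ioi_mem_nhds hx)).hasDerivAt⟩

/-- `A^{γ,b}` is contained in the generator: `1 - G` is onto for the generator `G`, and `1 - A` is
injective on the larger domain `D(A)` by the maximum principle. -/
theorem exists_hasGenerator_of_mem_besselDomain (hγ : 0 < γ) (hb : 0 ≤ b) {u : CZeroInfty 𝕜}
    (hu : u ∈ besselDomain 𝕜 γ b) : ∃ v, (besselSemigroup 𝕜 hγ hb).HasGenerator u v := by
  obtain ⟨a, hau, ha0⟩ := exists_onReal_eq_besselA hb hu
  obtain ⟨w, hw⟩ := C0Semigroup.exists_hasGenerator_sub_eq (isContraction_besselSemigroup hγ hb)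
    (dense_expSpan 𝕜) (fun u hu => by
      induction hu using Submodule.span_induction with
      | mem u hu =>
        obtain ⟨l, hl, rfl⟩ := hu
        exact (exists_hasGenerator_expNeg hγ hb hl).imp fun _ h => h.2
      | zero => exact (0 : (besselSemigroup 𝕜 hγ hb).generator.domain).2
      | add u u' _ _ hu hu' =>
        exact Submodule.add_mem (besselSemigroup 𝕜 hγ hb).generator.domain hu hu'
      | smul c u _ hu => exact Submodule.smul_mem (besselSemigroup 𝕜 hγ hb).generator.domain c hu)
    (besselSemigroup_op_mem_expSpan hγ hb) (u - a)
  have hweak := isWeakSolution_of_hasGenerator hγ hb hw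
  have hwD := hweak.mem_besselDomain hγ
  -- `u - w` lies in the kernel of `1 - A`.
  have hnonpos : ∀ (c : 𝕜) (x : ℝ), 0 ≤ x → RCLike.re (c * (onReal u x - onReal w x)) ≤ 0 := by
    intro c x hx
    let φ : 𝕜 →L[ℝ] ℝ := RCLike.reCLM.comp (ContinuousLinearMap.mul ℝ 𝕜 c)
    have hA : ∀ x, 0 < x → besselA γ b (onReal u) x - besselA γ b (onReal w) x =
        onReal u x - onReal w x := by
      intro x hx
      rw [hweak.besselA_eq hγ hx, ← hau x hx, onReal_sub, onReal_sub]
      abel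
    refine nonpos_of_besselA_eq_self hγ hb (g := fun x => φ (onReal u x - onReal w x))
      (g' := fun x => φ (deriv (onReal u) x - deriv (onReal w) x))
      (g'' := fun x => φ (deriv (deriv (onReal u)) x - deriv (deriv (onReal w)) x))
      (φ.continuous.comp ((continuous_onReal u).sub (continuous_onReal w)))
      ?_ (fun x hx => ?_) (fun x hx => ?_) (fun x hx => ?_) (fun hb0 => ?_) (fun hbp => ?_) hx
    · have h1 := (φ.continuous.tendsto _).comp (hu.2.2.2.sub hwD.2.2.2)
      rw [sub_zero, map_zero] at h1
      refine h1.congr' ?_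
      filter_upwards [eventually_gt_atTop 0] with x hx
      rw [Function.comp, hA x hx]
    · exact φ.hasFDerivAt.comp_hasDerivAt x ((hasDerivAt_deriv_of_contDiffOn_two hu.1 hx).1.fun_sub
        (hasDerivAt_deriv_of_contDiffOn_two hwD.1 hx).1)
    · exact φ.hasFDerivAt.comp_hasDerivAt x ((hasDerivAt_deriv_of_contDiffOn_two hu.1 hx).2.fun_sub
        (hasDerivAt_deriv_of_contDiffOn_two hwD.1 hx).2)
    · rw [← smul_eq_mul (γ * x), ← smul_eq_mul b, ← map_smul, ← map_smul, ← map_add, ← hA x hx,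
        besselA, besselA]
      congr 1
      module
    · have h1 := hweak.apply_zero hb0
      rw [onReal_sub, onReal_sub, ha0 hb0, sub_zero] at h1
      rw [← neg_sub (onReal w 0), h1, neg_zero, map_zero]
    · have h1 := (φ.continuous.tendsto _).comp ((hu.2.2.1 hbp).2.sub (hwD.2.2.1 hbp).2)
      rw [sub_zero, map_zero] at h1
      refine h1.congr fun x => ?_
      rw [Function.comp, ← smul_sub, map_smul, smul_eq_mul]
  have huw : u = w := by
    refine ext_onReal fun x hx => ?_
    have h1 := hnonpos ((starRingEnd 𝕜) (onReal u x - onReal w x)) x hx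
    rw [RCLike.conj_mul, ← RCLike.ofReal_pow, RCLike.ofReal_re] at h1
    rw [← sub_eq_zero, ← norm_eq_zero]
    exact pow_eq_zero_iff two_ne_zero |>.1 (le_antisymm h1 (sq_nonneg _))
  rw [huw]
  exact ⟨_, hw⟩

end Domain

theorem proposition3p3 {𝕜 : Type*} [RCLike 𝕜] (γ b : ℝ) (hγ : 0 < γ) (hb : 0 ≤ b) :
    ∃ S : C0Semigroup 𝕜 (CZeroInfty 𝕜),
      (∀ (t : ℝ≥0) (f : CZeroInfty 𝕜) (x : ℝ), 0 ≤ x →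
        onReal (S.op t f) x = besselP γ b t (onReal f) x) ∧
      (∀ u : CZeroInfty 𝕜, u ∈ S.generator.domain ↔ u ∈ besselDomain 𝕜 γ b) ∧
      (∀ (u : S.generator.domain) (x : ℝ), 0 < x →
        onReal (S.generator u) x = besselA γ b (onReal (u : CZeroInfty 𝕜)) x) := by
  refine ⟨besselSemigroup 𝕜 hγ hb, fun t f x hx => onReal_besselOp hγ hb t f hx,
    fun u => ⟨fun ⟨v, hv⟩ => ?_, fun hu => exists_hasGenerator_of_mem_besselDomain hγ hb hu⟩,
    fun u x hx => ?_⟩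
  · exact (isWeakSolution_of_hasGenerator hγ hb hv).mem_besselDomain hγ
  · exact ((isWeakSolution_of_hasGenerator hγ hb
      (C0Semigroup.hasGenerator_generator _ u)).besselA_eq hγ hx).symm
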